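/- Let $X \subset \mathbb{P}^3$ be a smooth quartic surface over $\mathbb{C}$ and let $l \subset X$ be a line. Call $l$ \emph{special} if one can choose homogeneous coordinates $x_0, x_1, x_2, x_3$ on $\mathbb{P}^3$ such that $l$ is given by $x_0 = x_1 = 0$ and $X$ is given by an equation $$x_0x_3^3 + x_1x_2^3 + x_2x_3\,q(x_0,x_1) + g(x_0,x_1) = 0,$$ where $q$ and $g$ are (possibly zero) homogeneous polynomials of degree $2$ and $4$, respectively. A \emph{symmetry} of $X$ is an automorphism of $X$ that is the restriction of an automorphism of $\mathbb{P}^3$; it is \emph{symplectic} if it acts trivially on the space $H^{2,0}(X)$ of global holomorphic $2$-forms on $X$. Then the following conditions are equivalent: (a) the line $l$ is special; (b) there exists a symplectic symmetry $\sigma \colon X \to X$ of order $3$ which preserves (as a set) each plane of $\mathbb{P}^3$ that contains $l$. -/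

import Mathlib

open scoped LinearAlgebra.Projectivization Topology

namespace QuarticSurface

/-- The vector space `ℂ⁴`, whose lines are the points of `ℙ³`. -/
abbrev V : Type := Fin 4 → ℂ

/-- `F` is an equation of a smooth quartic surface in `ℙ³`: a quartic form whose partial
derivatives have no common zero on the surface. -/
def IsSmoothQuartic (F : MvPolynomial (Fin 4) ℂ) : Prop :=
  F.IsHomogeneous 4 ∧
    ∀ v : V, v ≠ 0 → MvPolynomial.eval v F = 0 →
      ∃ i, MvPolynomial.eval v (MvPolynomial.pderiv i F) ≠ 0

/-- The surface `X = {F = 0}`, as a set of points of `ℙ³`. -/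
def surface (F : MvPolynomial (Fin 4) ℂ) : Set (ℙ ℂ V) :=
  {p | ∀ v ∈ p.submodule, MvPolynomial.eval v F = 0}

/-- A line of `ℙ³` is given by the 2-dimensional subspace `L` of `ℂ⁴`; it lies on `X = {F = 0}`
if `F` vanishes on `L`. -/
def IsLineOn (F : MvPolynomial (Fin 4) ℂ) (L : Submodule ℂ V) : Prop :=
  Module.finrank ℂ L = 2 ∧ ∀ v ∈ L, MvPolynomial.eval v F = 0

section Special

open MvPolynomial

/-- The equation `x₀x₃³ + x₁x₂³ + x₂x₃ q(x₀,x₁) + g(x₀,x₁)`. -/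
noncomputable def familyZ (q g : MvPolynomial (Fin 2) ℂ) : MvPolynomial (Fin 4) ℂ :=
  X 0 * X 3 ^ 3 + X 1 * X 2 ^ 3 + X 2 * X 3 * rename (Fin.castLE (by omega)) q
    + rename (Fin.castLE (by omega)) g

/-- The `i`-th coordinate of the coordinate system on `ℙ³` given by the invertible matrix `A`:
the linear form `∑ j, A i j x_j`. -/
noncomputable def newCoord (A : GL (Fin 4) ℂ) (i : Fin 4) : MvPolynomial (Fin 4) ℂ :=
  ∑ j, C ((A : Matrix (Fin 4) (Fin 4) ℂ) i j) * X j

/-- The line `L` on `X = {F = 0}` is special: there are coordinates `y₀, …, y₃` such that `L` is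
the line `y₀ = y₁ = 0` and an equation of `X` is
`y₀y₃³ + y₁y₂³ + y₂y₃ q(y₀,y₁) + g(y₀,y₁) = 0` with `q` and `g` (possibly zero) forms of degree
2 and 4. (Equations of `X` are unique up to a non-zero constant `c`.) -/
def IsSpecialLine (F : MvPolynomial (Fin 4) ℂ) (L : Submodule ℂ V) : Prop :=
  ∃ A : GL (Fin 4) ℂ,
    (∀ v : V, v ∈ L ↔ eval v (newCoord A 0) = 0 ∧ eval v (newCoord A 1) = 0) ∧
    ∃ (c : ℂ) (q g : MvPolynomial (Fin 2) ℂ), c ≠ 0 ∧ q.IsHomogeneous 2 ∧ g.IsHomogeneous 4 ∧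
      F = C c * bind₁ (newCoord A) (familyZ q g)

end Special

/-- The punctured affine cone `C* = {v ≠ 0 | F(v) = 0}` over `X`. It is a `ℂˣ`-bundle over `X`
through `v ↦ [v]`. -/
def cone (F : MvPolynomial (Fin 4) ℂ) : Set V :=
  {v | v ≠ 0 ∧ MvPolynomial.eval v F = 0}

/-- The tangent space of the cone at `v`: the kernel of `dF_v`. If `v` lies on the punctured cone
over a smooth surface, then the tangent space of `X` at `[v]` is its quotient by `ℂ v`, through
the differential of `v ↦ [v]`. -/
noncomputable def tangent (F : MvPolynomial (Fin 4) ℂ) (v : V) : Submodule ℂ V :=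
  LinearMap.ker (∑ i, MvPolynomial.eval v (MvPolynomial.pderiv i F) •
    (LinearMap.proj i : V →ₗ[ℂ] ℂ))

/-- `ω` represents a global holomorphic 2-form on `X = {F = 0}`, i.e. an element of
`H^{2,0}(X) = H⁰(X, Ω²)`.

A form on `X` is given by its pullback to the punctured cone `C*` along `v ↦ [v]`. The pullbacks
are exactly the holomorphic 2-forms on the complex manifold `C*` that are horizontal (they vanish
when one argument is tangent to the fibre, i.e. a multiple of `v`) and invariant under the
action of `ℂˣ`. Only the values of `ω v` on tangent vectors of `C*` at points `v` of `C*`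
matter. -/
structure IsHolomorphicTwoForm (F : MvPolynomial (Fin 4) ℂ) (ω : V → V [⋀^Fin 2]→L[ℂ] ℂ) :
    Prop where
  /-- Locally on `C*`, the form is the restriction of a holomorphic form on an open set of
  `ℂ⁴`. -/
  holomorphic : ∀ v ∈ cone F, ∃ η : V → V [⋀^Fin 2]→L[ℂ] ℂ, AnalyticAt ℂ η v ∧
    ∀ᶠ v' in 𝓝 v, v' ∈ cone F →
      ∀ u ∈ tangent F v', ∀ w ∈ tangent F v', ω v' ![u, w] = η v' ![u, w]
  horizontal : ∀ v ∈ cone F, ∀ u ∈ tangent F v, ω v ![v, u] = 0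
  invariant : ∀ v ∈ cone F, ∀ u ∈ tangent F v, ∀ w ∈ tangent F v, ∀ c : ℂ, c ≠ 0 →
    ω (c • v) ![c • u, c • w] = ω v ![u, w]

/-- The automorphism `σ` of `X` is the restriction of the automorphism of `ℙ³` given by `φ`.
So `σ` is a symmetry of `X` if there is such a `φ`. -/
def IsRestriction (F : MvPolynomial (Fin 4) ℂ) (σ : Equiv.Perm (surface F)) (φ : V ≃ₗ[ℂ] V) :
    Prop :=
  ∀ x : surface F, (σ x : ℙ ℂ V) = Projectivization.map φ.toLinearMap φ.injective (x : ℙ ℂ V)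

/-- The symmetry of `X = {F = 0}` induced by `φ` is symplectic: it acts trivially on
`H^{2,0}(X)`, i.e. `φ^* ω = ω` on `X` for each global holomorphic 2-form `ω` on `X`. -/
def IsSymplectic (F : MvPolynomial (Fin 4) ℂ) (φ : V ≃ₗ[ℂ] V) : Prop :=
  ∀ ω : V → V [⋀^Fin 2]→L[ℂ] ℂ, IsHolomorphicTwoForm F ω →
    ∀ v ∈ cone F, ∀ u ∈ tangent F v, ∀ w ∈ tangent F v,
      ω (φ v) ![φ u, φ w] = ω v ![u, w]

/-- The automorphism of `ℙ³` given by `φ` maps each plane that contains the line `L` to itself. -/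
def PreservesPlanesThrough (L : Submodule ℂ V) (φ : V ≃ₗ[ℂ] V) : Prop :=
  ∀ H : Submodule ℂ V, Module.finrank ℂ H = 3 → L ≤ H → H.map φ.toLinearMap = H

end QuarticSurface

/-! Special implies symmetry: in special coordinates `diag(1, 1, ζ, ζ²)`, with `ζ` a primitive cube
root of unity, preserves the equation, has determinant 1 and is the identity modulo `L`. It remains
to see that it fixes every holomorphic 2-form. The residue form `Ω`, characterised on the cone by
`det(x, v, u, w) = dF_v(x) · Ω_v(u, w)`, is multiplied by `det φ / χ` when `F ∘ φ = χ F`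
(`residueForm_map`), hence is fixed here. Any other 2-form is `h · Ω` with `h` a holomorphic
function on `X`, and `h` must be shown constant.

Connectedness of `X` is replaced by an argument with the special equation. By Liouville `h` is
constant on `L`. If `|h - h(L)|` had a positive maximum, the level set of a maximum point would be
closed, open by the maximum principle, and disjoint from `L`. Its slices with `y₀, y₁` fixed would
be compact and open in affine cubic curves, which is impossible because `|y₂|` can always be
increased (`coord_zero_eq_zero_of_isClosed`, `exists_const_mul_residueForm`).

Symmetry implies special: `F ∘ φ = χ F` by the Nullstellensatz, and testing on `Ω` gives `det φ =
χ`. Preserving all planes through `L` makes `φ` a scalar modulo `L`; rescaled, it has cube 1 and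
eigenvalues `1, 1, d₂, d₃`. Smoothness at a point of `L` forces `d₂ d₃ = 1`, so the map is `diag(1,
1, ζ, ζ²)` in a suitable frame. The invariant quartic monomials give the special shape, except that
`y₃³` and `y₂³` have linear forms in `y₀, y₁` as coefficients. Smoothness along `L` makes these
independent, so they can serve as new coordinates. -/

namespace QuarticSurface

/-! ### Quartic forms, their differentials, and forms vanishing on the surface. -/

section Polynomials

open MvPolynomial

variable {F G : MvPolynomial (Fin 4) ℂ}

/-- The differential of `F` at `v`, as a linear form on `ℂ⁴`. -/
noncomputable def diffForm (F : MvPolynomial (Fin 4) ℂ) (v : V) : V →ₗ[ℂ] ℂ :=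
  ∑ i, eval v (pderiv i F) • (LinearMap.proj i : V →ₗ[ℂ] ℂ)

lemma diffForm_apply (F : MvPolynomial (Fin 4) ℂ) (v w : V) :
    diffForm F v w = ∑ i, eval v (pderiv i F) * w i := by
  simp [diffForm, LinearMap.sum_apply]

lemma diffForm_single (F : MvPolynomial (Fin 4) ℂ) (v : V) (i : Fin 4) :
    diffForm F v (Pi.single i 1) = eval v (pderiv i F) := by
  simp [diffForm_apply, Pi.single_apply]

lemma mem_tangent {v w : V} : w ∈ tangent F v ↔ diffForm F v w = 0 := Iff.rfl

lemma hasFDerivAt_eval (F : MvPolynomial (Fin 4) ℂ) (v : V) :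
    HasFDerivAt (fun x : V => eval x F) (LinearMap.toContinuousLinearMap (diffForm F v)) v := by
  induction F using MvPolynomial.induction_on with
  | C a =>
    have : LinearMap.toContinuousLinearMap (diffForm (C a) v) = 0 := by
      ext w; simp [diffForm_apply]
    rw [this]
    simpa using hasFDerivAt_const a v
  | add p q hp hq =>
    have : LinearMap.toContinuousLinearMap (diffForm (p + q) v) =
        LinearMap.toContinuousLinearMap (diffForm p v) +
          LinearMap.toContinuousLinearMap (diffForm q v) := by
      ext w; simp [diffForm_apply, add_mul, Finset.sum_add_distrib]
    rw [this]
    simp only [map_add]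
    exact hp.add hq
  | mul_X p i hp =>
    have hX : HasFDerivAt (fun x : V => x i) (ContinuousLinearMap.proj (R := ℂ) i) v :=
      hasFDerivAt_apply i v
    have := hp.mul hX
    simp only [map_mul, eval_X]
    refine this.congr_fderiv ?_
    ext w
    simp [diffForm_apply, pderiv_X, Finset.sum_add_distrib, add_mul, Pi.single_apply,
      apply_ite, Finset.mul_sum, mul_assoc]

lemma analyticAt_eval (F : MvPolynomial (Fin 4) ℂ) (v : V) :
    AnalyticAt ℂ (fun x : V => eval x F) v := by
  have := AnalyticAt.aeval_mvPolynomial (𝕜 := ℂ) (f := fun x : V => x) (z := v)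
    (fun i => (ContinuousLinearMap.proj (R := ℂ) (φ := fun _ : Fin 4 => ℂ) i).analyticAt v) F
  simpa [aeval_eq_eval] using this

lemma continuous_eval' (F : MvPolynomial (Fin 4) ℂ) : Continuous fun x : V => eval x F :=
  MvPolynomial.continuous_eval F

lemma eval_smul_of_isHomogeneous {σ : Type*} {P : MvPolynomial σ ℂ} {n : ℕ}
    (hP : P.IsHomogeneous n) (c : ℂ) (v : σ → ℂ) : eval (c • v) P = c ^ n * eval v P := by
  rw [eval_eq, eval_eq, Finset.mul_sum]
  refine Finset.sum_congr rfl fun d hd => ?_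
  have : c ^ n = ∏ i ∈ d.support, c ^ d i := by
    rw [Finset.prod_pow_eq_pow_sum, ← hP (mem_support_iff.1 hd), Finsupp.weight_apply]
    simp [Finsupp.sum]
  rw [this, mul_left_comm, ← Finset.prod_mul_distrib]
  simp [mul_pow]

lemma diffForm_smul (hF : F.IsHomogeneous 4) (c : ℂ) (v : V) :
    diffForm F (c • v) = c ^ 3 • diffForm F v := by
  refine LinearMap.ext fun w => ?_
  have h : ∀ i, eval (c • v) (pderiv i F) = c ^ 3 * eval v (pderiv i F) := fun i =>
    eval_smul_of_isHomogeneous (n := 3) hF.pderiv c v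
  simp only [diffForm_apply, h, LinearMap.smul_apply, smul_eq_mul, Finset.mul_sum, mul_assoc]

lemma diffForm_self (hF : F.IsHomogeneous 4) (v : V) : diffForm F v v = 4 * eval v F := by
  have := congrArg (eval v) hF.sum_X_mul_pderiv
  simp only [map_sum, map_mul, eval_X, nsmul_eq_mul] at this
  rw [diffForm_apply]
  simpa [mul_comm] using this

lemma exists_pderiv_ne_zero (hF : IsSmoothQuartic F) {v : V} (hv : v ∈ cone F) :
    ∃ i, eval v (pderiv i F) ≠ 0 :=
  hF.2 v hv.1 hv.2

lemma diffForm_ne_zero (hF : IsSmoothQuartic F) {v : V} (hv : v ∈ cone F) :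
    diffForm F v ≠ 0 := by
  obtain ⟨i, hi⟩ := exists_pderiv_ne_zero hF hv
  intro h
  apply hi
  rw [← diffForm_single, h, LinearMap.zero_apply]

lemma self_mem_tangent (hF : IsSmoothQuartic F) {v : V} (hv : v ∈ cone F) :
    v ∈ tangent F v := by
  rw [mem_tangent, diffForm_self hF.1, hv.2, mul_zero]

lemma smul_mem_cone (hF : IsSmoothQuartic F) {v : V} (hv : v ∈ cone F) {c : ℂ} (hc : c ≠ 0) :
    c • v ∈ cone F :=
  ⟨smul_ne_zero hc hv.1, by rw [eval_smul_of_isHomogeneous hF.1, hv.2, mul_zero]⟩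

lemma tangent_smul (hF : IsSmoothQuartic F) (v : V) {c : ℂ} (hc : c ≠ 0) :
    tangent F (c • v) = tangent F v := by
  ext w
  simp [mem_tangent, diffForm_smul hF.1, hc]

lemma hasDerivAt_eval_line (F : MvPolynomial (Fin 4) ℂ) (v w : V) :
    HasDerivAt (fun t : ℂ => eval (v + t • w) F) (diffForm F v w) 0 := by
  have h1 : HasDerivAt (fun t : ℂ => v + t • w) w 0 := by
    simpa using ((hasDerivAt_id (0 : ℂ)).smul_const w).const_add v
  have h2 : HasFDerivAt (fun x : V => eval x F)
      (LinearMap.toContinuousLinearMap (diffForm F v)) (v + (0 : ℂ) • w) := by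
    simpa using hasFDerivAt_eval F v
  exact h2.comp_hasDerivAt (0 : ℂ) h1

lemma diffForm_map {φ : V →ₗ[ℂ] V} {χ : ℂ} (h : ∀ v, eval (φ v) F = χ * eval v F) (v w : V) :
    diffForm F (φ v) (φ w) = χ * diffForm F v w := by
  have h1 := hasDerivAt_eval_line F (φ v) (φ w)
  have h2 := (hasDerivAt_eval_line F v w).const_mul χ
  refine h1.unique (h2.congr_of_eventuallyEq (Filter.Eventually.of_forall fun t => ?_))
  simp [← h]

lemma diffForm_eq_zero_of_mem {L : Submodule ℂ V} (hL : ∀ v ∈ L, eval v F = 0) {v w : V}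
    (hv : v ∈ L) (hw : w ∈ L) : diffForm F v w = 0 := by
  have h := hasDerivAt_const (0 : ℂ) (0 : ℂ)
  exact (hasDerivAt_eval_line F v w).unique (h.congr_of_eventuallyEq
    (Filter.Eventually.of_forall fun t => hL _ (L.add_mem hv (L.smul_mem t hw))))

/-- The restriction of a polynomial to an affine line, as a polynomial in one variable. -/
lemma exists_polynomial_line (G : MvPolynomial (Fin 4) ℂ) (a b : V) :
    ∃ p : Polynomial ℂ, ∀ t, p.eval t = eval (a + t • b) G := by
  refine ⟨aeval (fun i => Polynomial.C (a i) + Polynomial.C (b i) * Polynomial.X) G, fun t => ?_⟩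
  induction G using MvPolynomial.induction_on with
  | C c => simp
  | add p q hp hq => simp [hp, hq]
  | mul_X p i hp => simp [hp, mul_comm t]

lemma eq_C_of_eval_eq {c : ℂ} (h : ∀ v : V, v ≠ 0 → eval v G = c) : G = C c := by
  -- The factor `X 0` takes care of the origin, where nothing is assumed about `G`.
  have : X 0 * (G - C c) = 0 := by
    refine MvPolynomial.funext fun v => ?_
    by_cases hv : v = 0
    · simp [hv]
    · simp [h v hv]
  rcases mul_eq_zero.1 this with h | h
  · exact absurd h (X_ne_zero 0)
  · exact sub_eq_zero.1 h

/-- A polynomial without non-trivial zeros is constant. -/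
lemma exists_eq_C_of_forall_ne_zero (h : ∀ v : V, v ≠ 0 → eval v G ≠ 0) : ∃ c, G = C c := by
  have key : ∀ a b : V, LinearIndependent ℂ ![a, b] → eval a G = eval b G := by
    intro a b hab
    -- The affine line through two independent vectors misses the origin, so `G` restricts to a
    -- one-variable polynomial without roots, a constant.
    obtain ⟨p, hp⟩ := exists_polynomial_line G a (b - a)
    have hroot : ∀ t, p.eval t ≠ 0 := by
      intro t
      rw [hp]
      refine h _ fun h0 => ?_
      have h0' : (1 - t) • a + t • b = 0 := by rw [← h0]; module
      have := LinearIndependent.pair_iff.1 hab _ _ h0'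
      have h1 := this.1
      rw [this.2] at h1
      norm_num at h1
    have hdeg : p.degree = 0 := by
      by_contra hd
      obtain ⟨t, ht⟩ := IsAlgClosed.exists_root p hd
      exact hroot t ht
    rw [Polynomial.eq_C_of_degree_eq_zero hdeg] at hp
    have h0 := hp 0
    have h1 := hp 1
    simp only [Polynomial.eval_C, zero_smul, add_zero, one_smul, add_sub_cancel] at h0 h1
    rw [← h0, ← h1]
  have hfr : 1 < Module.finrank ℂ V := by simp
  let a : V := Pi.single 0 1
  have ha : a ≠ 0 := by simp [a]
  refine ⟨eval a G, eq_C_of_eval_eq fun v hv => ?_⟩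
  by_cases hva : LinearIndependent ℂ ![v, a]
  · exact key v a hva
  · obtain ⟨c, hc⟩ := exists_linearIndependent_pair_of_one_lt_finrank hfr ha
    refine (key v c ?_).trans (key a c hc).symm
    rw [LinearIndependent.pair_iff' hv] at hva ⊢
    push Not at hva
    obtain ⟨s, hs⟩ := hva
    intro t ht
    rw [LinearIndependent.pair_iff' ha] at hc
    have hs0 : s ≠ 0 := by rintro rfl; exact ha (by rw [← hs, zero_smul])
    refine hc (t * s⁻¹) ?_
    rw [← hs, smul_smul, mul_assoc, inv_mul_cancel₀ hs0, mul_one, ht]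

lemma ne_zero_of_isSmoothQuartic (hF : IsSmoothQuartic F) : F ≠ 0 := by
  rintro rfl
  obtain ⟨i, hi⟩ := hF.2 (Pi.single 0 1) (by simp) (by simp)
  simp at hi

/-- If `F = G²K`, then `F` and all its partial derivatives vanish at the zeros of `G`. So `G` has no
non-trivial zero and is constant. -/
lemma squarefree_of_isSmoothQuartic (hF : IsSmoothQuartic F) : Squarefree F := by
  rintro G ⟨K, rfl⟩
  have hG0 : G ≠ 0 := by rintro rfl; exact ne_zero_of_isSmoothQuartic hF (by simp)
  obtain ⟨c, rfl⟩ : ∃ c, G = C c := by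
    refine exists_eq_C_of_forall_ne_zero fun v hv hv0 => ?_
    obtain ⟨i, hi⟩ := hF.2 v hv (by simp [hv0])
    simp [hv0] at hi
  have hc : c ≠ 0 := by rintro rfl; simp at hG0
  exact (isUnit_iff_ne_zero.2 hc).map C

/-- A polynomial that vanishes on a smooth quartic surface is a multiple of its equation. -/
lemma dvd_of_eval_eq_zero (hF : IsSmoothQuartic F) (h : ∀ v, eval v F = 0 → eval v G = 0) :
    F ∣ G := by
  have h1 : G ∈ (Ideal.span {F}).radical := by
    rw [← vanishingIdeal_zeroLocus_eq_radical (K := ℂ), mem_vanishingIdeal_iff]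
    intro x hx
    rw [aeval_eq_eval]
    refine h x ?_
    have := hx F (Ideal.subset_span rfl)
    simpa [aeval_eq_eval] using this
  obtain ⟨n, hn⟩ := h1
  rw [Ideal.mem_span_singleton] at hn
  exact (squarefree_of_isSmoothQuartic hF).isRadical n G hn

lemma eval_zero_of_isHomogeneous {n : ℕ} (hn : n ≠ 0) (hG : G.IsHomogeneous n) :
    eval 0 G = 0 := by
  have := eval_smul_of_isHomogeneous hG 0 0
  simpa [hn] using this

lemma dvd_of_cone (hF : IsSmoothQuartic F) {n : ℕ} (hn : n ≠ 0) (hG : G.IsHomogeneous n)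
    (h : ∀ v ∈ cone F, eval v G = 0) : F ∣ G := by
  refine dvd_of_eval_eq_zero hF fun v hv => ?_
  by_cases h0 : v = 0
  · rw [h0]; exact eval_zero_of_isHomogeneous hn hG
  · exact h v ⟨h0, hv⟩

lemma eq_zero_of_cone_of_lt (hF : IsSmoothQuartic F) {n : ℕ} (hn : n ≠ 0) (hn4 : n < 4)
    (hG : G.IsHomogeneous n) (h : ∀ v ∈ cone F, eval v G = 0) : G = 0 := by
  obtain ⟨K, hK⟩ := dvd_of_cone hF hn hG h
  by_contra hG0
  have hF0 := ne_zero_of_isSmoothQuartic hF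
  have hK0 : K ≠ 0 := by rintro rfl; simp [hK] at hG0
  have h1 := hG.totalDegree hG0
  rw [hK, totalDegree_mul_of_isDomain hF0 hK0, hF.1.totalDegree hF0] at h1
  omega

lemma exists_eq_C_mul_of_cone (hF : IsSmoothQuartic F) (hG : G.IsHomogeneous 4)
    (h : ∀ v ∈ cone F, eval v G = 0) : ∃ c, G = C c * F := by
  obtain ⟨K, hK⟩ := dvd_of_cone hF (by norm_num) hG h
  by_cases hG0 : G = 0
  · exact ⟨0, by simp [hG0]⟩
  have hF0 := ne_zero_of_isSmoothQuartic hF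
  have hK0 : K ≠ 0 := by rintro rfl; simp [hK] at hG0
  have h1 := hG.totalDegree hG0
  rw [hK, totalDegree_mul_of_isDomain hF0 hK0, hF.1.totalDegree hF0] at h1
  have h2 : K.totalDegree = 0 := by omega
  exact ⟨_, by rw [hK, ← totalDegree_eq_zero_iff_eq_C.1 h2, mul_comm]⟩

/-- The `i`-th coordinate of `φ`, as a linear form. -/
noncomputable def coordForm (φ : V →ₗ[ℂ] V) (i : Fin 4) : MvPolynomial (Fin 4) ℂ :=
  ∑ j, C (φ (Pi.single j 1) i) * X j

lemma isHomogeneous_coordForm (φ : V →ₗ[ℂ] V) (i : Fin 4) : (coordForm φ i).IsHomogeneous 1 :=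
  IsHomogeneous.sum _ _ _ fun j _ => (isHomogeneous_X _ j).C_mul _

lemma eval_coordForm (φ : V →ₗ[ℂ] V) (i : Fin 4) (v : V) : eval v (coordForm φ i) = φ v i := by
  rw [LinearMap.pi_apply_eq_sum_univ φ v]
  simp only [coordForm, map_sum, map_mul, eval_C, eval_X, Finset.sum_apply, Pi.smul_apply,
    smul_eq_mul]
  refine Finset.sum_congr rfl fun j _ => ?_
  rw [mul_comm]
  congr 2
  refine congrFun (congrArg φ (funext fun k => ?_)) i
  simp [Pi.single_apply, eq_comm]

lemma eval_bind₁ {σ τ : Type*} (g : σ → MvPolynomial τ ℂ) (P : MvPolynomial σ ℂ) (v : τ → ℂ) :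
    eval v (bind₁ g P) = eval (fun i => eval v (g i)) P := by
  simpa [aeval_eq_eval] using aeval_bind₁ v g P

/-- `F ∘ φ` is a quartic form vanishing on the cone, hence a constant multiple of `F`. -/
lemma exists_eval_map_eq (hF : IsSmoothQuartic F) (φ : V ≃ₗ[ℂ] V)
    (h : ∀ v ∈ cone F, φ v ∈ cone F) :
    ∃ χ : ℂ, χ ≠ 0 ∧ ∀ v, eval (φ v) F = χ * eval v F := by
  have hev : ∀ v, eval v (aeval (coordForm φ.toLinearMap) F) = eval (φ v) F := by
    intro v
    rw [aeval_eq_bind₁, eval_bind₁]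
    simp only [eval_coordForm]
    rfl
  obtain ⟨χ, hχ⟩ := exists_eq_C_mul_of_cone hF (G := aeval (coordForm φ.toLinearMap) F)
    (by simpa using hF.1.aeval _ (isHomogeneous_coordForm φ.toLinearMap))
    (fun v hv => by rw [hev]; exact (h v hv).2)
  have h2 : ∀ v, eval (φ v) F = χ * eval v F := fun v => by rw [← hev, hχ]; simp
  refine ⟨χ, ?_, h2⟩
  rintro rfl
  refine ne_zero_of_isSmoothQuartic hF (MvPolynomial.funext fun v => ?_)
  have := h2 (φ.symm v)
  simpa using this

/-- A linear map for which each point of a smooth quartic surface is fixed is a homothety. -/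
lemma exists_eq_smul_of_forall_cone (hF : IsSmoothQuartic F) (φ : V →ₗ[ℂ] V)
    (h : ∀ v ∈ cone F, ∃ c : ℂ, φ v = c • v) : ∃ μ : ℂ, ∀ v, φ v = μ • v := by
  -- The 2×2 minors of `(φ v, v)` are quadrics vanishing on the surface, and no nonzero form of
  -- degree less than 4 does so.
  have h1 : ∀ i j, ∀ v, φ v i * v j - φ v j * v i = 0 := by
    intro i j v
    have := eq_zero_of_cone_of_lt hF (n := 2) (by norm_num) (by norm_num)
      (G := coordForm φ i * X j - coordForm φ j * X i)
      (((isHomogeneous_coordForm φ i).mul (isHomogeneous_X _ j)).sub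
        ((isHomogeneous_coordForm φ j).mul (isHomogeneous_X _ i)))
      (fun v hv => by
        obtain ⟨c, hc⟩ := h v hv
        simp only [map_sub, map_mul, eval_coordForm, eval_X, hc, Pi.smul_apply, smul_eq_mul]
        ring)
    simpa [eval_coordForm] using congrArg (eval v) this
  have h2 : ∀ v, ∃ c : ℂ, φ v = c • v := by
    intro v
    by_cases hv : v = 0
    · exact ⟨0, by simp [hv]⟩
    · obtain ⟨j, hj⟩ := Function.ne_iff.1 hv
      simp only [Pi.zero_apply] at hj
      refine ⟨φ v j / v j, funext fun i => ?_⟩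
      simp only [Pi.smul_apply, smul_eq_mul]
      field_simp
      linear_combination h1 i j v
  obtain ⟨μ, hμ⟩ := φ.exists_eq_smul_id_of_forall_notLinearIndependent fun v hv => by
    obtain ⟨c, hc⟩ := h2 v
    have := LinearIndependent.pair_iff.1 hv c (-1) (by rw [hc]; module)
    norm_num at this
  exact ⟨μ, fun v => by rw [hμ]; simp⟩

end Polynomials

end QuarticSurface

namespace QuarticSurface

/-! ### The residue 2-form and its behaviour under linear maps. -/

section Residue

open MvPolynomial

variable {F : MvPolynomial (Fin 4) ℂ}

/-- The determinant, as a continuous alternating form on `ℂ⁴`. -/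
noncomputable def detForm : V [⋀^Fin 4]→L[ℂ] ℂ :=
  { (Matrix.detRowAlternating : V [⋀^Fin 4]→ₗ[ℂ] ℂ) with
    cont := Continuous.matrix_det continuous_id }

lemma detForm_apply (m : Fin 4 → V) : detForm m = (Matrix.of m).det := rfl

lemma detForm_map (φ : V →ₗ[ℂ] V) (m : Fin 4 → V) :
    detForm (φ ∘ m) = LinearMap.det φ * detForm m := by
  have := (Pi.basisFun ℂ (Fin 4)).det_comp φ m
  rwa [Pi.basisFun_det] at this

lemma detForm_eq_zero_of_mem_ker {ℓ : V →ₗ[ℂ] ℂ} (hℓ : ℓ ≠ 0) {m : Fin 4 → V}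
    (hm : ∀ i, ℓ (m i) = 0) : detForm m = 0 := by
  rw [detForm_apply, ← Matrix.exists_mulVec_eq_zero_iff]
  refine ⟨fun i => ℓ (Pi.single i 1), ?_, ?_⟩
  · intro h
    refine hℓ (LinearMap.pi_ext' fun i => LinearMap.ext_ring ?_)
    simpa using congrFun h i
  · funext i
    have h := LinearMap.pi_apply_eq_sum_univ ℓ (m i)
    rw [hm i] at h
    rw [Pi.zero_apply, h, Matrix.mulVec, dotProduct]
    refine Finset.sum_congr rfl fun j _ => ?_
    rw [smul_eq_mul]
    congr 2
    funext k
    simp [Pi.single_apply, eq_comm]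

lemma detForm_ne_zero {m : Fin 4 → V} (hm : LinearIndependent ℂ m) : detForm m ≠ 0 := by
  have : IsUnit (Matrix.of m) := Matrix.linearIndependent_rows_iff_isUnit.1 hm
  rw [detForm_apply]
  rw [Matrix.isUnit_iff_isUnit_det] at this
  exact this.ne_zero

/-- A vector field on the punctured cone on which `dF` is `1`. -/
noncomputable def normal (F : MvPolynomial (Fin 4) ℂ) (v : V) : V :=
  (∑ i, eval v (pderiv i F) * star (eval v (pderiv i F)))⁻¹ •
    fun i => star (eval v (pderiv i F))

lemma diffForm_normal {v : V} (h : ∃ i, eval v (pderiv i F) ≠ 0) :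
    diffForm F v (normal F v) = 1 := by
  rw [normal, map_smul, diffForm_apply, smul_eq_mul]
  refine inv_mul_cancel₀ fun h0 => ?_
  obtain ⟨i, hi⟩ := h
  have h1 : ∑ i, Complex.normSq (eval v (pderiv i F)) = 0 := by
    rw [← Complex.ofReal_inj]
    push_cast
    rw [← h0]
    exact Finset.sum_congr rfl fun j _ => (Complex.mul_conj _).symm
  rw [Finset.sum_eq_zero_iff_of_nonneg fun j _ => Complex.normSq_nonneg _] at h1
  exact hi (Complex.normSq_eq_zero.1 (h1 i (Finset.mem_univ i)))

/-- The residue of the standard 3-form with a pole along the surface, pulled back to the cone. -/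
noncomputable def residueForm (F : MvPolynomial (Fin 4) ℂ) (v : V) : V [⋀^Fin 2]→L[ℂ] ℂ :=
  (detForm.curryLeft (normal F v)).curryLeft v

lemma residueForm_apply (v u w : V) :
    residueForm F v ![u, w] = detForm ![normal F v, v, u, w] := rfl

/-- The vectors `x - dF(x) n`, `v`, `u`, `w`, with `n` the normal, all lie in the hyperplane `ker
dF`, so their determinant is zero. Thus any transversal vector can replace `normal F v`. -/
lemma detForm_eq_mul_residueForm (hF : IsSmoothQuartic F) {v u w : V} (hv : v ∈ cone F)
    (hu : u ∈ tangent F v) (hw : w ∈ tangent F v) (x : V) :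
    detForm ![x, v, u, w] = diffForm F v x * residueForm F v ![u, w] := by
  have h0 : detForm ![x - diffForm F v x • normal F v, v, u, w] = 0 := by
    refine detForm_eq_zero_of_mem_ker (diffForm_ne_zero hF hv) fun i => ?_
    fin_cases i
    · simp [diffForm_normal (exists_pderiv_ne_zero hF hv)]
    · exact self_mem_tangent hF hv
    · exact hu
    · exact hw
  have h1 : ∀ y, detForm ![y, v, u, w] = detForm.curryLeft y ![v, u, w] := fun y => rfl
  rw [residueForm_apply, h1, h1]
  rw [h1, map_sub, map_smul] at h0
  simpa [sub_eq_zero] using h0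

lemma detForm_smul_smul_smul (x a b d : V) (c : ℂ) :
    detForm ![x, c • a, c • b, c • d] = c ^ 3 * detForm ![x, a, b, d] := by
  have := detForm.map_smul_univ ![1, c, c, c] ![x, a, b, d]
  simp only [Fin.prod_univ_four, Matrix.cons_val_zero, Matrix.cons_val_one, Matrix.cons_val,
    smul_eq_mul] at this
  rw [show c ^ 3 = 1 * c * c * c by ring, ← this]
  congr 1
  funext i
  fin_cases i <;> simp

lemma analyticAt_smul_curryLeft {i : Fin 4} {v : V} (hi : eval v (pderiv i F) ≠ 0) :
    AnalyticAt ℂ (fun x => (eval x (pderiv i F))⁻¹ •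
      (detForm.curryLeft (Pi.single i 1)).curryLeft x) v :=
  ((analyticAt_eval _ v).inv hi).smul (ContinuousLinearMap.analyticAt _ v)

/-- `normal` involves complex conjugation; this local formula shows that the residue form is
nevertheless holomorphic. -/
lemma residueForm_eq_of_ne_zero (hF : IsSmoothQuartic F) {i : Fin 4} {v u w : V}
    (hi : eval v (pderiv i F) ≠ 0) (hv : v ∈ cone F) (hu : u ∈ tangent F v)
    (hw : w ∈ tangent F v) :
    residueForm F v ![u, w] =
      (eval v (pderiv i F))⁻¹ * detForm ![Pi.single i 1, v, u, w] := by
  rw [detForm_eq_mul_residueForm hF hv hu hw, diffForm_single, inv_mul_cancel_left₀ hi]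

lemma eventually_pderiv_ne_zero {i : Fin 4} {v : V} (hi : eval v (pderiv i F) ≠ 0) :
    ∀ᶠ x in 𝓝 v, eval x (pderiv i F) ≠ 0 :=
  (continuous_eval' (pderiv i F)).continuousAt.eventually_ne hi

/-- Invariance is where degree 4 enters: `dF` has weight 3, which cancels the scaling of the three
vectors `v`, `u`, `w`. -/
lemma isHolomorphicTwoForm_residueForm (hF : IsSmoothQuartic F) :
    IsHolomorphicTwoForm F (residueForm F) where
  holomorphic v hv := by
    obtain ⟨i, hi⟩ := exists_pderiv_ne_zero hF hv
    refine ⟨_, analyticAt_smul_curryLeft hi, ?_⟩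
    filter_upwards [eventually_pderiv_ne_zero hi] with x hx hxc u hu w hw
    exact residueForm_eq_of_ne_zero hF hx hxc hu hw
  horizontal v hv u hu := by
    rw [residueForm_apply]
    exact detForm.map_eq_zero_of_eq _ (i := 1) (j := 2) rfl (by decide)
  invariant v hv u hu w hw c hc := by
    have h := detForm_eq_mul_residueForm hF (smul_mem_cone hF hv hc)
      (u := c • u) (w := c • w)
      (by rw [tangent_smul hF v hc]; exact Submodule.smul_mem _ _ hu)
      (by rw [tangent_smul hF v hc]; exact Submodule.smul_mem _ _ hw) (normal F v)
    rw [detForm_smul_smul_smul, diffForm_smul hF.1, LinearMap.smul_apply,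
      diffForm_normal (exists_pderiv_ne_zero hF hv), smul_eq_mul, mul_one,
      ← residueForm_apply] at h
    exact (mul_left_cancel₀ (pow_ne_zero 3 hc) h).symm

lemma map_mem_cone (φ : V ≃ₗ[ℂ] V) {χ : ℂ} (h : ∀ v, eval (φ v) F = χ * eval v F) {v : V}
    (hv : v ∈ cone F) : φ v ∈ cone F :=
  ⟨by simpa using hv.1, by rw [h, hv.2, mul_zero]⟩

lemma map_mem_tangent (φ : V ≃ₗ[ℂ] V) {χ : ℂ} (h : ∀ v, eval (φ v) F = χ * eval v F) {v u : V}
    (hu : u ∈ tangent F v) : φ u ∈ tangent F (φ v) := by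
  have := diffForm_map (φ := φ.toLinearMap) h v u
  rw [mem_tangent] at hu ⊢
  rw [hu, mul_zero] at this
  exact this

/-- In the identity defining the residue, `φ` multiplies the determinant by `det φ` and `dF` by `χ`.
-/
lemma residueForm_map (hF : IsSmoothQuartic F) (φ : V ≃ₗ[ℂ] V) {χ : ℂ}
    (h : ∀ v, eval (φ v) F = χ * eval v F) {v u w : V} (hv : v ∈ cone F)
    (hu : u ∈ tangent F v) (hw : w ∈ tangent F v) :
    χ * residueForm F (φ v) ![φ u, φ w] =
      LinearMap.det φ.toLinearMap * residueForm F v ![u, w] := by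
  have h1 := detForm_eq_mul_residueForm hF (map_mem_cone φ h hv) (map_mem_tangent φ h hu)
    (map_mem_tangent φ h hw) (φ (normal F v))
  have h2 := diffForm_map (φ := φ.toLinearMap) h v (normal F v)
  rw [diffForm_normal (exists_pderiv_ne_zero hF hv), mul_one] at h2
  simp only [LinearEquiv.coe_coe] at h2
  rw [h2] at h1
  rw [← h1, residueForm_apply, ← detForm_map]
  congr 1
  funext i
  fin_cases i <;> rfl

/-- Two tangent vectors which, with `v`, are a basis of the tangent space of the cone. -/
lemma exists_linearIndependent_normal (hF : IsSmoothQuartic F) {v : V} (hv : v ∈ cone F) :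
    ∃ u ∈ tangent F v, ∃ w ∈ tangent F v, LinearIndependent ℂ ![normal F v, v, u, w] := by
  have hℓ := diffForm_ne_zero hF hv
  have hfr : Module.finrank ℂ (tangent F v) = 3 := by
    have := Module.Dual.finrank_ker_add_one_of_ne_zero (f := diffForm F v) hℓ
    rw [Module.finrank_fin_fun] at this
    change Module.finrank ℂ (LinearMap.ker (diffForm F v)) = 3
    omega
  let v' : tangent F v := ⟨v, self_mem_tangent hF hv⟩
  have hv' : v' ≠ 0 := fun h => hv.1 (congrArg Subtype.val h)
  obtain ⟨u, hu⟩ := exists_linearIndependent_pair_of_one_lt_finrank (R := ℂ)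
    (by rw [hfr]; norm_num) hv'
  obtain ⟨w, hw⟩ := exists_linearIndependent_snoc_of_lt_finrank hu (by rw [hfr]; norm_num)
  refine ⟨u, u.2, w, w.2, ?_⟩
  have h3 : LinearIndependent ℂ ![v, (u : V), (w : V)] := by
    have := hw.map' (tangent F v).subtype (Submodule.ker_subtype _)
    have heq : (tangent F v).subtype ∘ (Fin.snoc ![v', u] w : Fin 3 → tangent F v) =
        ![v, (u : V), (w : V)] := by
      funext i
      fin_cases i <;> rfl
    rwa [heq] at this
  have hn := diffForm_normal (exists_pderiv_ne_zero hF hv)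
  refine linearIndependent_finCons.2 ⟨h3, fun hmem => ?_⟩
  have hle : Submodule.span ℂ (Set.range ![v, (u : V), (w : V)]) ≤ tangent F v := by
    rw [Submodule.span_le]
    rintro _ ⟨i, rfl⟩
    fin_cases i
    · exact v'.2
    · exact u.2
    · exact w.2
  have := hle hmem
  rw [mem_tangent, hn] at this
  exact one_ne_zero this

/-- The residue form is nonzero at every point of the cone, so one point suffices to compare the
factors; the line supplies such a point. -/
lemma det_eq_of_isSymplectic (hF : IsSmoothQuartic F) {L : Submodule ℂ V} (hL : IsLineOn F L)
    (φ : V ≃ₗ[ℂ] V) {χ : ℂ} (h : ∀ v, eval (φ v) F = χ * eval v F) (hφ : IsSymplectic F φ) :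
    LinearMap.det φ.toLinearMap = χ := by
  obtain ⟨v, hvL, hv0⟩ : ∃ v ∈ L, v ≠ 0 := by
    apply Submodule.exists_mem_ne_zero_of_ne_bot
    rintro rfl
    have := hL.1
    simp at this
  have hv : v ∈ cone F := ⟨hv0, hL.2 v hvL⟩
  obtain ⟨u, hu, w, hw, hind⟩ := exists_linearIndependent_normal hF hv
  have h1 := residueForm_map hF φ h hv hu hw
  rw [hφ _ (isHolomorphicTwoForm_residueForm hF) v hv u hu w hw] at h1
  exact (mul_right_cancel₀ (detForm_ne_zero hind) h1).symm

lemma map_vec2_expand (A : V [⋀^Fin 2]→L[ℂ] ℂ) (x y : V) :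
    A ![x, y] = (A.curryLeft x).curryLeft y ![] := rfl

lemma map_vec2_self (A : V [⋀^Fin 2]→L[ℂ] ℂ) (x : V) : A ![x, x] = 0 :=
  A.map_eq_zero_of_eq _ (i := 0) (j := 1) rfl (by decide)

lemma map_vec2_swap (A : V [⋀^Fin 2]→L[ℂ] ℂ) (x y : V) : A ![y, x] = -A ![x, y] := by
  have := map_vec2_self A (x + y)
  simp only [map_vec2_expand, map_add, ContinuousAlternatingMap.add_apply,
    ContinuousAlternatingMap.curryLeft_add, add_apply] at this
  simp only [← map_vec2_expand, map_vec2_self] at this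
  linear_combination this

/-- Since `A` kills `v` against both `u` and `w`, only the 2×2 determinant of the `u, w` coordinates
contributes. -/
lemma map_vec2_horizontal (A : V [⋀^Fin 2]→L[ℂ] ℂ) {v u w : V} (hu : A ![v, u] = 0)
    (hw : A ![v, w] = 0) (a b c a' b' c' : ℂ) :
    A ![a • v + b • u + c • w, a' • v + b' • u + c' • w] =
      (b * c' - c * b') * A ![u, w] := by
  simp only [map_vec2_expand, map_add, map_smul, ContinuousAlternatingMap.add_apply,
    ContinuousAlternatingMap.smul_apply, ContinuousAlternatingMap.curryLeft_smul,
    ContinuousAlternatingMap.curryLeft_add, add_apply,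
    smul_apply, smul_eq_mul]
  simp only [← map_vec2_expand, map_vec2_self, hu, hw, map_vec2_swap A v u, map_vec2_swap A v w,
    map_vec2_swap A u w]
  ring

/-- A holomorphic 2-form is a function times the residue form. -/
lemma exists_eq_mul_residueForm (hF : IsSmoothQuartic F) {ω : V → V [⋀^Fin 2]→L[ℂ] ℂ}
    (hω : IsHolomorphicTwoForm F ω) :
    ∃ h : V → ℂ, ∀ v ∈ cone F, ∀ u ∈ tangent F v, ∀ w ∈ tangent F v,
      ω v ![u, w] = h v * residueForm F v ![u, w] := by
  have key : ∀ v, ∃ c, v ∈ cone F → ∀ u ∈ tangent F v, ∀ w ∈ tangent F v,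
      ω v ![u, w] = c * residueForm F v ![u, w] := by
    intro v
    by_cases hv : v ∈ cone F
    swap
    · exact ⟨0, fun h => absurd h hv⟩
    obtain ⟨u₀, hu₀, w₀, hw₀, hind⟩ := exists_linearIndependent_normal hF hv
    have hne : residueForm F v ![u₀, w₀] ≠ 0 := detForm_ne_zero hind
    refine ⟨ω v ![u₀, w₀] / residueForm F v ![u₀, w₀], fun _ => ?_⟩
    have hdec : ∀ u ∈ tangent F v, ∃ a b c : ℂ, u = a • v + b • u₀ + c • w₀ := by
      intro u hu
      have hspan := hind.span_eq_top_of_card_eq_finrank (by simp)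
      have hmem : u ∈ Submodule.span ℂ (Set.range ![normal F v, v, u₀, w₀]) := by
        rw [hspan]; trivial
      rw [Submodule.mem_span_range_iff_exists_fun] at hmem
      obtain ⟨c, hc⟩ := hmem
      simp only [Fin.sum_univ_four, Matrix.cons_val_zero, Matrix.cons_val_one,
        Matrix.cons_val] at hc
      have h0 := congrArg (diffForm F v) hc
      simp only [map_add, map_smul, mem_tangent.1 hu, mem_tangent.1 hu₀, mem_tangent.1 hw₀,
        mem_tangent.1 (self_mem_tangent hF hv), diffForm_normal (exists_pderiv_ne_zero hF hv),
        smul_eq_mul, mul_one, mul_zero, add_zero] at h0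
      refine ⟨c 1, c 2, c 3, ?_⟩
      rw [← hc, h0, zero_smul, zero_add]
    intro u hu w hw
    obtain ⟨a, b, c, rfl⟩ := hdec u hu
    obtain ⟨a', b', c', rfl⟩ := hdec w hw
    have hres := isHolomorphicTwoForm_residueForm hF
    rw [map_vec2_horizontal _ (hω.horizontal v hv _ hu₀) (hω.horizontal v hv _ hw₀),
      map_vec2_horizontal _ (hres.horizontal v hv _ hu₀) (hres.horizontal v hv _ hw₀)]
    field_simp
  choose h hh using key
  exact ⟨h, hh⟩

end Residue

end QuarticSurface

namespace QuarticSurface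

/-! ### Holomorphic functions on the surface: analyticity, maximum principle, slices of the cone. -/

section Uniqueness

open MvPolynomial

variable {F : MvPolynomial (Fin 4) ℂ} {ω : V → V [⋀^Fin 2]→L[ℂ] ℂ} {h : V → ℂ}

/-- The vector field `u - (dF(u) / ∂ᵢF) eᵢ` is tangent to the cone. -/
lemma sub_smul_single_mem_tangent {i : Fin 4} {x : V} (hx : eval x (pderiv i F) ≠ 0) (u : V) :
    u - (diffForm F x u / eval x (pderiv i F)) • Pi.single i 1 ∈ tangent F x := by
  rw [mem_tangent, map_sub, map_smul, diffForm_single, smul_eq_mul, div_mul_cancel₀ _ hx, sub_self]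

lemma map_vec2_sub_smul (A : V [⋀^Fin 2]→L[ℂ] ℂ) (u w e : V) (a b : ℂ) :
    A ![u - a • e, w - b • e] = A ![u, w] - b * A ![u, e] - a * A ![e, w] := by
  have h1 := map_vec2_self A e
  rw [map_vec2_expand] at h1
  simp only [sub_eq_add_neg, ← neg_smul, map_vec2_expand, map_add, map_smul,
    ContinuousAlternatingMap.add_apply, ContinuousAlternatingMap.smul_apply,
    ContinuousAlternatingMap.curryLeft_smul, ContinuousAlternatingMap.curryLeft_add, add_apply,
    smul_apply, smul_eq_mul, h1]
  ring

lemma detForm_sub_smul (e x u w : V) (a b : ℂ) :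
    detForm ![e, x, u - a • e, w - b • e] = detForm ![e, x, u, w] := by
  have h1 : ∀ y z, detForm ![e, x, y, z] = ((detForm.curryLeft e).curryLeft x) ![y, z] :=
    fun y z => rfl
  have h2 : ∀ y, detForm ![e, x, e, y] = 0 := fun y =>
    detForm.map_eq_zero_of_eq _ (i := 0) (j := 2) rfl (by decide)
  have h3 : ∀ y, detForm ![e, x, y, e] = 0 := fun y =>
    detForm.map_eq_zero_of_eq _ (i := 0) (j := 3) rfl (by decide)
  rw [h1, map_vec2_sub_smul, ← h1, ← h1, ← h1, h2, h3]
  ring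

lemma analyticAt_diffForm (F : MvPolynomial (Fin 4) ℂ) (u v : V) :
    AnalyticAt ℂ (fun x => diffForm F x u) v := by
  simp only [diffForm_apply]
  exact Finset.analyticAt_fun_sum _ fun i _ => (analyticAt_eval _ v).mul analyticAt_const

/-- Fixed `u`, `w` are corrected along `eᵢ` to fields that are tangent at nearby points and depend
analytically on `x`; `h` is the quotient of the values of the two forms on them. -/
lemma exists_analyticAt_eq (hF : IsSmoothQuartic F) (hω : IsHolomorphicTwoForm F ω)
    (hh : ∀ v ∈ cone F, ∀ u ∈ tangent F v, ∀ w ∈ tangent F v,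
      ω v ![u, w] = h v * residueForm F v ![u, w]) {v : V} (hv : v ∈ cone F) :
    ∃ H : V → ℂ, AnalyticAt ℂ H v ∧ ∀ᶠ x in 𝓝 v, x ∈ cone F → h x = H x := by
  obtain ⟨i, hi⟩ := exists_pderiv_ne_zero hF hv
  obtain ⟨η, hη, hηω⟩ := hω.holomorphic v hv
  obtain ⟨u, hu, w, hw, hind⟩ := exists_linearIndependent_normal hF hv
  let e : V := Pi.single i 1
  let a : V → ℂ := fun x => diffForm F x u / eval x (pderiv i F)
  let b : V → ℂ := fun x => diffForm F x w / eval x (pderiv i F)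
  let R : V → ℂ := fun x => (eval x (pderiv i F))⁻¹ * detForm ![e, x, u, w]
  let N : V → ℂ := fun x => η x ![u, w] - b x * η x ![u, e] - a x * η x ![e, w]
  have ha : AnalyticAt ℂ a v := (analyticAt_diffForm F u v).div (analyticAt_eval _ v) hi
  have hb : AnalyticAt ℂ b v := (analyticAt_diffForm F w v).div (analyticAt_eval _ v) hi
  have happ : ∀ m : Fin 2 → V, AnalyticAt ℂ (fun x => η x m) v := fun m =>
    ((ContinuousAlternatingMap.apply ℂ V ℂ m).analyticAt (η v)).comp hη
  have hR : AnalyticAt ℂ R v :=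
    ((ContinuousAlternatingMap.apply ℂ V ℂ ![u, w]).analyticAt _).comp
      (analyticAt_smul_curryLeft hi)
  have hN : AnalyticAt ℂ N v := ((happ _).sub (hb.mul (happ _))).sub (ha.mul (happ _))
  have hRv : R v ≠ 0 := by
    have h1 : residueForm F v ![u, w] = R v := residueForm_eq_of_ne_zero hF hi hv hu hw
    rw [← h1]
    exact detForm_ne_zero hind
  refine ⟨fun x => N x / R x, hN.div hR hRv, ?_⟩
  filter_upwards [eventually_pderiv_ne_zero hi, hηω, hR.continuousAt.eventually_ne hRv]
    with x hx hxη hxR hxc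
  have hu' := sub_smul_single_mem_tangent hx u
  have hw' := sub_smul_single_mem_tangent hx w
  have h1 := hh x hxc _ hu' _ hw'
  rw [hxη hxc _ hu' _ hw', residueForm_eq_of_ne_zero hF hx hxc hu' hw', detForm_sub_smul,
    map_vec2_sub_smul] at h1
  rw [eq_div_iff hxR]
  exact h1.symm

lemma coefficient_smul (hF : IsSmoothQuartic F) (hω : IsHolomorphicTwoForm F ω)
    (hh : ∀ v ∈ cone F, ∀ u ∈ tangent F v, ∀ w ∈ tangent F v,
      ω v ![u, w] = h v * residueForm F v ![u, w]) {v : V} (hv : v ∈ cone F) {c : ℂ}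
    (hc : c ≠ 0) : h (c • v) = h v := by
  obtain ⟨u, hu, w, hw, hind⟩ := exists_linearIndependent_normal hF hv
  have hne : residueForm F v ![u, w] ≠ 0 := detForm_ne_zero hind
  have hres := isHolomorphicTwoForm_residueForm hF
  have h1 := hh (c • v) (smul_mem_cone hF hv hc) (c • u)
    (by rw [tangent_smul hF v hc]; exact Submodule.smul_mem _ _ hu) (c • w)
    (by rw [tangent_smul hF v hc]; exact Submodule.smul_mem _ _ hw)
  rw [hω.invariant v hv u hu w hw c hc, hres.invariant v hv u hu w hw c hc,
    hh v hv u hu w hw] at h1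
  exact (mul_right_cancel₀ hne h1).symm

open scoped ContDiff in
/-- The maximum principle on the cone over a smooth quartic surface. -/
lemma eventually_eq_of_forall_norm_le (hF : IsSmoothQuartic F) {v : V} (hv : v ∈ cone F)
    {H : V → ℂ} (hH : AnalyticAt ℂ H v) (hhH : ∀ᶠ x in 𝓝 v, x ∈ cone F → h x = H x) {c₀ : ℂ}
    (hmax : ∀ x ∈ cone F, ‖h x - c₀‖ ≤ ‖h v - c₀‖) :
    ∀ᶠ x in 𝓝 v, x ∈ cone F → h x = h v := by
  set ℓ : V →L[ℂ] ℂ := LinearMap.toContinuousLinearMap (diffForm F v) with hℓ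
  set n : V := normal F v with hn
  have hℓn : ℓ n = 1 := diffForm_normal (exists_pderiv_ne_zero hF hv)
  -- `Φ` straightens the cone near `v`: its derivative there is the identity, and `ℓ ∘ Φ = F` turns
  -- the cone into the hyperplane `ℓ = 0`.
  let Φ : V → V := fun x => x - ℓ x • n + eval x F • n
  have hℓΦ : ∀ x, ℓ (Φ x) = eval x F := by
    intro x
    simp only [Φ, map_add, map_sub, map_smul, hℓn, smul_eq_mul]
    ring
  have hΦa : AnalyticAt ℂ Φ v :=
    (analyticAt_id.sub ((ℓ.analyticAt v).smul analyticAt_const)).add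
      ((analyticAt_eval F v).smul analyticAt_const)
  have hΦc : ContDiffAt ℂ ω Φ v := hΦa.contDiffAt
  have hΦd : HasFDerivAt Φ ((ContinuousLinearEquiv.refl ℂ V : V ≃L[ℂ] V) : V →L[ℂ] V) v := by
    have h1 := ((hasFDerivAt_id v).sub (ℓ.hasFDerivAt.smul_const n)).add
      ((hasFDerivAt_eval F v).smul_const n)
    refine h1.congr_fderiv ?_
    ext x i
    simp [hℓ]
  have hstrict := hΦc.hasStrictFDerivAt' hΦd (by simp)
  set Ψ : V → V := hΦc.localInverse hΦd (by simp) with hΨ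
  have hΨa : AnalyticAt ℂ Ψ (Φ v) :=
    (hΦc.to_localInverse hΦd (by simp)).analyticAt
  have hΨv : Ψ (Φ v) = v := hΦc.localInverse_apply_image hΦd (by simp)
  have hleft : ∀ᶠ x in 𝓝 v, Ψ (Φ x) = x := hstrict.eventually_left_inverse
  have hright : ∀ᶠ y in 𝓝 (Φ v), Φ (Ψ y) = y := hstrict.eventually_right_inverse
  have hℓc : ℓ (Φ v) = 0 := by rw [hℓΦ, hv.2]
  let π : V → V := fun y => y - ℓ y • n
  have hℓπ : ∀ y, ℓ (π y) = 0 := fun y => by simp [π, hℓn]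
  have hπ : ∀ y, ℓ y = 0 → π y = y := fun y hy => by simp [π, hy]
  have hπa : AnalyticAt ℂ π (Φ v) :=
    analyticAt_id.sub ((ℓ.analyticAt _).smul analyticAt_const)
  have hπc : π (Φ v) = Φ v := hπ _ hℓc
  have hΨπ : AnalyticAt ℂ (fun y => Ψ (π y)) (Φ v) :=
    AnalyticAt.fun_comp (by rwa [hπc]) hπa
  have hΨπv : Ψ (π (Φ v)) = v := by rw [hπc, hΨv]
  -- Projecting to the hyperplane by `π` makes `f` analytic on an open set of `ℂ⁴`, so the usual
  -- maximum principle applies.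
  let f : V → ℂ := fun y => H (Ψ (π y)) - c₀
  have hfa : AnalyticAt ℂ f (Φ v) :=
    (AnalyticAt.fun_comp (g := H) (by rwa [hΨπv]) hΨπ).sub analyticAt_const
  have hHv : h v = H v := hhH.self_of_nhds hv
  have hfv : f (Φ v) = h v - c₀ := by simp only [f, hΨπv, hHv]
  have htend : Filter.Tendsto (fun y => Ψ (π y)) (𝓝 (Φ v)) (𝓝 v) := by
    have := hΨπ.continuousAt.tendsto
    rwa [hΨπv] at this
  have htendπ : Filter.Tendsto π (𝓝 (Φ v)) (𝓝 (Φ v)) := by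
    have := hπa.continuousAt.tendsto
    rwa [hπc] at this
  have hloc : IsLocalMax (norm ∘ f) (Φ v) := by
    filter_upwards [htendπ.eventually hright, htend.eventually hhH,
      htend.eventually (isOpen_ne.mem_nhds hv.1 : ∀ᶠ x in 𝓝 v, x ≠ 0)] with y hy hyH hy0
    have hcone : Ψ (π y) ∈ cone F := ⟨hy0, by rw [← hℓΦ, hy, hℓπ]⟩
    simp only [Function.comp, hfv]
    simp only [f, ← hyH hcone]
    exact hmax _ hcone
  have hconst := Complex.eventually_eq_of_isLocalMax_norm
    (hfa.eventually_analyticAt.mono fun y hy => hy.differentiableAt) hloc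
  filter_upwards [hΦa.continuousAt.tendsto.eventually hconst, hleft, hhH] with x hx hxl hxH hxc
  rw [hfv] at hx
  have hπx : π (Φ x) = Φ x := hπ _ (by rw [hℓΦ, hxc.2])
  simp only [f, hπx, hxl] at hx
  rw [hxH hxc]
  exact sub_left_injective hx

lemma continuousOn_of_eventually_eq
    (hH : ∀ v ∈ cone F, ∃ H : V → ℂ, AnalyticAt ℂ H v ∧ ∀ᶠ x in 𝓝 v, x ∈ cone F → h x = H x) :
    ContinuousOn h (cone F) := by
  intro v hv
  obtain ⟨H, hHa, hHe⟩ := hH v hv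
  refine (hHa.continuousAt.continuousWithinAt).congr_of_eventuallyEq ?_ (hHe.self_of_nhds hv)
  exact eventually_nhdsWithin_iff.2 hHe

/-- By scale invariance the supremum over the cone is the one over its compact intersection with the
unit sphere. -/
lemma exists_forall_norm_le (hF : IsSmoothQuartic F) (hne : (cone F).Nonempty)
    (hc : ContinuousOn h (cone F))
    (hs : ∀ v ∈ cone F, ∀ c : ℂ, c ≠ 0 → h (c • v) = h v) (c₀ : ℂ) :
    ∃ v ∈ cone F, ∀ x ∈ cone F, ‖h x - c₀‖ ≤ ‖h v - c₀‖ := by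
  have hnorm : ∀ x ∈ cone F, ∃ c : ℂ, c ≠ 0 ∧ c • x ∈ Metric.sphere (0 : V) 1 := by
    intro x hx
    have hx0 : ‖x‖ ≠ 0 := norm_ne_zero_iff.2 hx.1
    refine ⟨(‖x‖ : ℂ)⁻¹, by simpa using hx.1, ?_⟩
    simp [norm_smul, hx0]
  have hcomp : IsCompact (Metric.sphere (0 : V) 1 ∩ {x | eval x F = 0}) :=
    (isCompact_sphere 0 1).inter_right (isClosed_eq (continuous_eval' F) continuous_const)
  have hsub : Metric.sphere (0 : V) 1 ∩ {x | eval x F = 0} ⊆ cone F := by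
    rintro x ⟨hx, hx0⟩
    refine ⟨?_, hx0⟩
    rintro rfl
    simp at hx
  obtain ⟨x₀, hx₀⟩ := hne
  obtain ⟨d, hd, hdx⟩ := hnorm x₀ hx₀
  obtain ⟨v, hv, hvmax⟩ := hcomp.exists_isMaxOn ⟨d • x₀, hdx, (smul_mem_cone hF hx₀ hd).2⟩
    (((hc.mono hsub).sub continuousOn_const).norm (f := fun x => h x - c₀))
  refine ⟨v, hsub hv, fun x hx => ?_⟩
  obtain ⟨c, hc0, hcx⟩ := hnorm x hx
  rw [← hs x hx c hc0]
  exact hvmax ⟨hcx, (smul_mem_cone hF hx hc0).2⟩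

/-- A bounded holomorphic function on the cone is constant along a line (Liouville). -/
lemma eq_of_mem_line (hF : IsSmoothQuartic F) {L : Submodule ℂ V} (hL : IsLineOn F L)
    (hH : ∀ v ∈ cone F, ∃ H : V → ℂ, AnalyticAt ℂ H v ∧ ∀ᶠ x in 𝓝 v, x ∈ cone F → h x = H x)
    (hs : ∀ v ∈ cone F, ∀ c : ℂ, c ≠ 0 → h (c • v) = h v) {x y : V} (hx : x ∈ L) (hx0 : x ≠ 0)
    (hy : y ∈ L) (hy0 : y ≠ 0) : h x = h y := by
  have hcone : ∀ z ∈ L, z ≠ 0 → z ∈ cone F := fun z hz hz0 => ⟨hz0, hL.2 z hz⟩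
  by_cases hxy : LinearIndependent ℂ ![x, y]
  · have hmem : ∀ t : ℂ, x + t • (y - x) ∈ cone F := by
      intro t
      refine hcone _ (L.add_mem hx (L.smul_mem t (L.sub_mem hy hx))) fun h0 => ?_
      have h0' : (1 - t) • x + t • y = 0 := by rw [← h0]; module
      have := LinearIndependent.pair_iff.1 hxy _ _ h0'
      have h1 := this.1
      rw [this.2] at h1
      norm_num at h1
    have hline : Continuous fun t : ℂ => x + t • (y - x) := by fun_prop
    have hdiff : Differentiable ℂ fun t : ℂ => h (x + t • (y - x)) := by
      intro t
      obtain ⟨H, hHa, hHe⟩ := hH _ (hmem t)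
      have h1 : DifferentiableAt ℂ (fun t : ℂ => H (x + t • (y - x))) t :=
        DifferentiableAt.comp (g := H) (f := fun t : ℂ => x + t • (y - x)) t
          hHa.differentiableAt (by fun_prop)
      refine h1.congr_of_eventuallyEq ?_
      filter_upwards [hline.continuousAt.tendsto.eventually hHe] with s hs'
      exact hs' (hmem s)
    obtain ⟨v, -, hv⟩ := exists_forall_norm_le hF ⟨x, hcone x hx hx0⟩
      (continuousOn_of_eventually_eq hH) hs 0
    have hb : Bornology.IsBounded (Set.range fun t : ℂ => h (x + t • (y - x))) := by
      refine (Metric.isBounded_closedBall (x := (0 : ℂ)) (r := ‖h v‖)).subset ?_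
      rintro _ ⟨t, rfl⟩
      simpa using hv _ (hmem t)
    have := hdiff.apply_eq_apply_of_bounded hb 0 1
    simpa using this
  · rw [LinearIndependent.pair_iff' hx0] at hxy
    push Not at hxy
    obtain ⟨a, rfl⟩ := hxy
    exact (hs x (hcone x hx hx0) a (by rintro rfl; simp at hy0)).symm

/-- Continuity of roots, in a weak form. -/
lemma exists_root_dist_lt {p : Polynomial ℂ} {δ : ℝ} (hδ : 0 ≤ δ) {t : ℂ}
    (hlt : ‖p.eval t‖ < ‖p.leadingCoeff‖ * δ ^ p.natDegree) :
    ∃ r, p.eval r = 0 ∧ ‖t - r‖ < δ := by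
  -- If all roots were at distance at least `δ` from `t`, the factorisation would bound `‖p(t)‖`
  -- below by `‖lead‖ δ^deg`.
  have key : ∀ s : Multiset ℂ, (∀ r ∈ s, δ ≤ ‖t - r‖) →
      δ ^ Multiset.card s ≤ ‖(s.map fun r => t - r).prod‖ := by
    intro s
    induction s using Multiset.induction_on with
    | empty => simp
    | cons a s ih =>
      intro hs
      have h1 := hs a (Multiset.mem_cons_self a s)
      have h2 := ih fun r hr => hs r (Multiset.mem_cons_of_mem hr)
      simp only [Multiset.card_cons, Multiset.map_cons, Multiset.prod_cons, norm_mul, pow_succ']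
      exact mul_le_mul h1 h2 (by positivity) (by positivity)
  by_contra! hcon
  have hsp := IsAlgClosed.splits p
  have hp0 : p ≠ 0 := by rintro rfl; simp at hlt
  have h1 := key p.roots fun r hr => hcon r (Polynomial.isRoot_of_mem_roots hr)
  rw [← hsp.natDegree_eq_card_roots] at h1
  have h2 : p.eval t = p.leadingCoeff * (p.roots.map fun r => t - r).prod := by
    conv_lhs => rw [hsp.eq_prod_roots]
    rw [Polynomial.eval_mul, Polynomial.eval_C, Polynomial.eval_multiset_prod, Multiset.map_map]
    simp
  rw [h2, norm_mul] at hlt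
  exact absurd hlt (not_lt.2 (by gcongr))

/-- The cubic curves `a y₃³ + b y₂³ + q y₂y₃ + g = 0` with `a ≠ 0` move continuously
with `y₂`. -/
lemma eventually_exists_root {a b q g s t : ℂ} (ha : a ≠ 0)
    (h0 : a * t ^ 3 + b * s ^ 3 + s * t * q + g = 0) {ε : ℝ} (hε : 0 < ε) :
    ∀ᶠ s' in 𝓝 s, ∃ t', ‖t - t'‖ < ε ∧ a * t' ^ 3 + b * s' ^ 3 + s' * t' * q + g = 0 := by
  have hcont : Continuous fun s' : ℂ => ‖a * t ^ 3 + b * s' ^ 3 + s' * t * q + g‖ := by fun_prop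
  have hlt : ‖a * t ^ 3 + b * s ^ 3 + s * t * q + g‖ < ‖a‖ * ε ^ 3 := by
    rw [h0, norm_zero]
    have := norm_pos_iff.2 ha
    positivity
  filter_upwards [hcont.continuousAt.eventually_lt continuousAt_const hlt] with s' hs'
  let p : Polynomial ℂ := Polynomial.C a * Polynomial.X ^ 3 + Polynomial.C 0 * Polynomial.X ^ 2 +
    Polynomial.C (s' * q) * Polynomial.X + Polynomial.C (b * s' ^ 3 + g)
  have hp : ∀ r, p.eval r = a * r ^ 3 + b * s' ^ 3 + s' * r * q + g := by
    intro r
    simp [p]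
    ring
  have hd : p.natDegree = 3 := Polynomial.natDegree_cubic ha
  have hl : p.leadingCoeff = a := Polynomial.leadingCoeff_cubic ha
  obtain ⟨r, hr, hrt⟩ := exists_root_dist_lt (p := p) hε.le (t := t) (by rwa [hp, hd, hl])
  exact ⟨r, hrt, by rw [← hp, hr]⟩

/-- A closed and open part of the cone over a surface `y₀y₃³ + y₁y₂³ + y₂y₃ q + g = 0` that
avoids the line `y₀ = y₁ = 0` lies in the plane `y₀ = 0`. -/
lemma coord_zero_eq_zero_of_isClosed (Q G : ℂ → ℂ → ℂ) {D : Set V}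
    (hD : ∀ y ∈ D, y 0 * y 3 ^ 3 + y 1 * y 2 ^ 3 + y 2 * y 3 * Q (y 0) (y 1) + G (y 0) (y 1) = 0)
    (hDL : ∀ y ∈ D, y 0 ≠ 0 ∨ y 1 ≠ 0)
    (hDs : ∀ y ∈ D, ∀ c : ℂ, c ≠ 0 → c • y ∈ D) (hDc : IsClosed (insert 0 D))
    (hDo : ∀ y ∈ D, ∀ᶠ x in 𝓝 y, x 0 * x 3 ^ 3 + x 1 * x 2 ^ 3 + x 2 * x 3 * Q (x 0) (x 1) +
      G (x 0) (x 1) = 0 → x ∈ D) {p : V} (hp : p ∈ D) : p 0 = 0 := by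
  by_contra hp0
  have hne : ∀ y ∈ D, y ≠ 0 := by
    rintro _ hy rfl
    simpa using hDL 0 hy
  have hnorm : ∀ x ∈ D, (‖x‖ : ℂ)⁻¹ • x ∈ Metric.sphere (0 : V) 1 ∩ insert 0 D := by
    intro x hx
    have hx0 : ‖x‖ ≠ 0 := norm_ne_zero_iff.2 (hne x hx)
    exact ⟨by simp [norm_smul, hx0], Or.inr (hDs x hx _ (by simpa using hne x hx))⟩
  have hcomp : IsCompact (Metric.sphere (0 : V) 1 ∩ insert 0 D) :=
    (isCompact_sphere 0 1).inter_right hDc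
  -- As `D` avoids the line, `|y₀| + |y₁|` has a positive minimum on the unit vectors of `D`; so
  -- `y₀, y₁` control the norm on `D`.
  obtain ⟨m, ⟨hm1, hm2⟩, hmin⟩ := hcomp.exists_isMinOn ⟨_, hnorm p hp⟩
    (f := fun y : V => ‖y 0‖ + ‖y 1‖) (by fun_prop)
  have hmD : m ∈ D := by
    rcases hm2 with rfl | hm2
    · simp at hm1
    · exact hm2
  set δ : ℝ := ‖m 0‖ + ‖m 1‖ with hδ
  have hδ0 : 0 < δ := by
    rcases hDL m hmD with h | h
    · have := norm_pos_iff.2 h; positivity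
    · have := norm_pos_iff.2 h; positivity
  have hbound : ∀ y ∈ D, ‖y‖ ≤ (‖y 0‖ + ‖y 1‖) / δ := by
    intro y hy
    have h1 := hmin (hnorm y hy)
    have hy0 : 0 < ‖y‖ := norm_pos_iff.2 (hne y hy)
    simp only [Set.mem_ofPred_eq, Pi.smul_apply, norm_smul, norm_inv, Complex.norm_real, norm_norm,
      ← hδ, ← mul_add] at h1
    rw [le_div_iff₀ hδ0]
    rw [le_inv_mul_iff₀ hy0] at h1
    exact h1
  -- The slice of `D` with `y₀, y₁` fixed lies on an affine cubic curve and is compact by `hbound`.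
  let γ : ℂ × ℂ → V := fun z => ![p 0, p 1, z.1, z.2]
  have hγ : Continuous γ := by
    refine continuous_pi fun i => ?_
    fin_cases i <;> simp [γ] <;> fun_prop
  have hKc : IsClosed {z | γ z ∈ D} := by
    have : {z | γ z ∈ D} = γ ⁻¹' (insert 0 D) := by
      ext z
      refine ⟨Or.inr, fun hz => hz.resolve_left fun h0 => hp0 ?_⟩
      simpa [γ] using congrFun h0 0
    rw [this]
    exact hDc.preimage hγ
  have hK : IsCompact {z | γ z ∈ D} := by
    refine Metric.isCompact_of_isClosed_isBounded hKc ?_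
    refine (Metric.isBounded_closedBall (x := (0 : ℂ × ℂ))
      (r := (‖p 0‖ + ‖p 1‖) / δ)).subset fun z hz => ?_
    have h1 := hbound _ hz
    have h2 : ‖z.1‖ ≤ ‖γ z‖ := norm_le_pi_norm (γ z) 2
    have h3 : ‖z.2‖ ≤ ‖γ z‖ := norm_le_pi_norm (γ z) 3
    simp only [mem_closedBall_zero_iff, Prod.norm_def]
    exact (max_le h2 h3).trans h1
  have hpK : (p 2, p 3) ∈ {z | γ z ∈ D} := by
    have : γ (p 2, p 3) = p := by
      funext i
      fin_cases i <;> rfl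
    rw [Set.mem_ofPred_eq, this]
    exact hp
  obtain ⟨⟨s, t⟩, hst, hmax⟩ := hK.exists_isMaxOn ⟨_, hpK⟩
    (f := fun z : ℂ × ℂ => ‖z.1‖) (by fun_prop)
  obtain ⟨ε, hε, hball⟩ := Metric.eventually_nhds_iff.1 (hDo _ hst)
  have hroot := eventually_exists_root (b := p 1) (q := Q (p 0) (p 1)) (g := G (p 0) (p 1))
    (s := s) (t := t) hp0 (by simpa [γ] using hD _ hst) hε
  have hclose : ∀ᶠ s' in 𝓝 s, dist s' s < ε := Metric.ball_mem_nhds s hε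
  -- Moving `s` in the direction `d` increases `|s|`. The root `t` follows since `p 0 ≠ 0`, and
  -- openness keeps the point in `D`, against maximality of `|s|`.
  let d : ℂ := if s = 0 then 1 else s
  have hpath : Filter.Tendsto (fun η : ℝ => s + (η : ℂ) * d) (𝓝[>] 0) (𝓝 s) := by
    have : Continuous fun η : ℝ => s + (η : ℂ) * d := by fun_prop
    have h1 := this.tendsto 0
    simp only [Complex.ofReal_zero, zero_mul, add_zero] at h1
    exact h1.mono_left nhdsWithin_le_nhds
  obtain ⟨η, ⟨⟨t', ht', hroot'⟩, hs'⟩, hη⟩ :=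
    ((hpath.eventually (hroot.and hclose)).and self_mem_nhdsWithin).exists
  have hη0 : 0 < η := hη
  set s' : ℂ := s + (η : ℂ) * d with hs'def
  have hmem : γ (s', t') ∈ D := by
    refine hball ?_ (by simpa [γ] using hroot')
    rw [dist_pi_lt_iff hε]
    intro i
    fin_cases i
    · simpa [γ] using hε
    · simpa [γ] using hε
    · simpa [γ] using hs'
    · simpa [γ, dist_eq_norm, norm_sub_rev] using ht'
  have hle : ‖s'‖ ≤ ‖s‖ := hmax hmem
  by_cases hs0 : s = 0
  · rw [hs'def] at hle
    simp only [d, hs0, if_true, zero_add, mul_one, norm_zero, Complex.norm_real,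
      Real.norm_eq_abs] at hle
    exact hη0.ne' (abs_nonpos_iff.1 hle)
  · have : s' = ((1 + η : ℝ) : ℂ) * s := by
      rw [hs'def]
      simp only [d, hs0, if_false]
      push_cast
      ring
    rw [this, norm_mul, Complex.norm_real, Real.norm_of_nonneg (by positivity)] at hle
    have := norm_pos_iff.2 hs0
    nlinarith

end Uniqueness

end QuarticSurface

namespace QuarticSurface

/-! ### Holomorphic 2-forms on a quartic with a special line. -/

section SpecialForm

open MvPolynomial

variable {F : MvPolynomial (Fin 4) ℂ}

lemma eval_familyZ (q g : MvPolynomial (Fin 2) ℂ) (y : V) :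
    eval y (familyZ q g) = y 0 * y 3 ^ 3 + y 1 * y 2 ^ 3 + y 2 * y 3 * eval ![y 0, y 1] q +
      eval ![y 0, y 1] g := by
  have h : y ∘ (Fin.castLE (by omega) : Fin 2 → Fin 4) = ![y 0, y 1] := by
    funext i
    fin_cases i <;> rfl
  simp [familyZ, eval_rename, h]

/-- `T` gives coordinates in which `F` is `c` times the special form given by `q` and `g`, and
`L` is the line `y₀ = y₁ = 0`. -/
structure IsSpecialFrame (F : MvPolynomial (Fin 4) ℂ) (L : Submodule ℂ V) (T : V ≃ₗ[ℂ] V) (c : ℂ)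
    (q g : MvPolynomial (Fin 2) ℂ) : Prop where
  ne_zero : c ≠ 0
  mem_iff : ∀ y, T y ∈ L ↔ y 0 = 0 ∧ y 1 = 0
  eval_eq : ∀ y, eval (T y) F = c * eval y (familyZ q g)

lemma eval_newCoord (A : GL (Fin 4) ℂ) (i : Fin 4) (v : V) :
    eval v (newCoord A i) = ((A : Matrix (Fin 4) (Fin 4) ℂ).mulVec v) i := by
  simp [newCoord, Matrix.mulVec, dotProduct]

/-- The linear automorphism of `ℂ⁴` given by an invertible matrix. -/
noncomputable def glEquiv (A : GL (Fin 4) ℂ) : V ≃ₗ[ℂ] V :=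
  Matrix.toLin'OfInv (M := ((A⁻¹ : GL (Fin 4) ℂ) : Matrix (Fin 4) (Fin 4) ℂ))
    (M' := (A : Matrix (Fin 4) (Fin 4) ℂ)) (by simp) (by simp)

lemma glEquiv_apply (A : GL (Fin 4) ℂ) (v : V) :
    glEquiv A v = (A : Matrix (Fin 4) (Fin 4) ℂ).mulVec v := rfl

lemma exists_isSpecialFrame {L : Submodule ℂ V} (h : IsSpecialLine F L) :
    ∃ T c q g, q.IsHomogeneous 2 ∧ g.IsHomogeneous 4 ∧ IsSpecialFrame F L T c q g := by
  obtain ⟨A, hA, c, q, g, hc, hq, hg, hFA⟩ := h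
  have hcoord : ∀ (i : Fin 4) (y : V), eval ((glEquiv A).symm y) (newCoord A i) = y i := by
    intro i y
    rw [eval_newCoord, ← glEquiv_apply, LinearEquiv.apply_symm_apply]
  refine ⟨(glEquiv A).symm, c, q, g, hq, hg, hc, fun y => ?_, fun y => ?_⟩
  · rw [hA, hcoord, hcoord]
  · rw [hFA, map_mul, eval_C, eval_bind₁]
    simp only [hcoord]

lemma map_mem_cone_iff {T : V ≃ₗ[ℂ] V} {y : V} :
    T y ∈ cone F ↔ y ≠ 0 ∧ eval (T y) F = 0 := by
  simp [cone]

/-- A closed and open part of the cone over a special quartic that avoids the special line is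
empty. -/
lemma not_mem_of_isClosed_of_isOpen {L : Submodule ℂ V} {T : V ≃ₗ[ℂ] V} {c : ℂ}
    {q g : MvPolynomial (Fin 2) ℂ} (hT : IsSpecialFrame F L T c q g) {D : Set V}
    (hD : D ⊆ cone F) (hDL : ∀ v ∈ D, v ∉ L) (hDs : ∀ v ∈ D, ∀ c : ℂ, c ≠ 0 → c • v ∈ D)
    (hDc : IsClosed (insert 0 D)) (hDo : ∀ v ∈ D, ∀ᶠ x in 𝓝 v, x ∈ cone F → x ∈ D) (v : V) :
    v ∉ D := by
  intro hv
  have hTc : Continuous T := LinearMap.continuous_of_finiteDimensional T.toLinearMap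
  have hins : insert 0 (T ⁻¹' D) = T ⁻¹' (insert 0 D) := by
    ext y
    simp
  have hclosed : IsClosed (insert 0 (T ⁻¹' D)) := by
    rw [hins]
    exact hDc.preimage hTc
  have hzero : ∀ y ∈ T ⁻¹' D, eval y (familyZ q g) = 0 := by
    intro y hy
    have := (hD hy).2
    rw [hT.eval_eq] at this
    exact (mul_eq_zero.1 this).resolve_left hT.ne_zero
  have hne : ∀ y ∈ T ⁻¹' D, y 0 ≠ 0 ∨ y 1 ≠ 0 := by
    intro y hy
    have := hDL _ hy
    rw [hT.mem_iff] at this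
    tauto
  have hopen : ∀ y ∈ T ⁻¹' D, ∀ᶠ x in 𝓝 y, eval x (familyZ q g) = 0 → x ∈ T ⁻¹' D := by
    intro y hy
    have hy0 : y ≠ 0 := (map_mem_cone_iff.1 (hD hy)).1
    filter_upwards [hTc.continuousAt.tendsto.eventually (hDo _ hy), isOpen_ne.mem_nhds hy0]
      with x hx hx0 hxF
    exact hx (map_mem_cone_iff.2 ⟨hx0, by rw [hT.eval_eq, hxF, mul_zero]⟩)
  have hs : ∀ y ∈ T ⁻¹' D, ∀ c : ℂ, c ≠ 0 → c • y ∈ T ⁻¹' D := by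
    intro y hy a ha
    rw [Set.mem_preimage, map_smul]
    exact hDs _ hy a ha
  have hp : T.symm v ∈ T ⁻¹' D := by simpa using hv
  have h0 : T.symm v 0 = 0 := by
    refine coord_zero_eq_zero_of_isClosed (fun a b => eval ![a, b] q) (fun a b => eval ![a, b] g)
      (D := T ⁻¹' D) (fun y hy => ?_) hne hs hclosed (fun y hy => ?_) hp
    · rw [← eval_familyZ]
      exact hzero y hy
    · simpa only [eval_familyZ] using hopen y hy
  -- The swap `y₀ ↔ y₁`, `y₂ ↔ y₃` keeps the shape of the equation, so the same argument gives `y₁ =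
  -- 0`: the point is on the line.
  let s : V → V := fun y => ![y 1, y 0, y 3, y 2]
  have hss : ∀ y, s (s y) = y := fun y => by
    funext i
    fin_cases i <;> rfl
  have hsc : Continuous s := by
    refine continuous_pi fun i => ?_
    fin_cases i <;> simp [s] <;> fun_prop
  have hs0 : s 0 = 0 := by
    funext i
    fin_cases i <;> rfl
  have hev : ∀ y : V, eval (s y) (familyZ q g) = y 0 * y 3 ^ 3 + y 1 * y 2 ^ 3 +
      y 2 * y 3 * eval ![y 1, y 0] q + eval ![y 1, y 0] g := by
    intro y
    rw [eval_familyZ]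
    simp only [s, Matrix.cons_val_zero, Matrix.cons_val_one, Matrix.cons_val]
    ring
  have h1 : s (T.symm v) 0 = 0 := by
    refine coord_zero_eq_zero_of_isClosed (fun a b => eval ![b, a] q) (fun a b => eval ![b, a] g)
      (D := s ⁻¹' (T ⁻¹' D)) (fun y hy => ?_) (fun y hy => (hne _ hy).symm) (fun y hy a ha => ?_)
      ?_ (fun y hy => ?_) (by rw [Set.mem_preimage, hss]; exact hp)
    · rw [← hev]
      exact hzero _ hy
    · have : s (a • y) = a • s y := by
        funext i
        fin_cases i <;> rfl
      rw [Set.mem_preimage, this]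
      exact hs _ hy a ha
    · have : insert 0 (s ⁻¹' (T ⁻¹' D)) = s ⁻¹' (insert 0 (T ⁻¹' D)) := by
        ext y
        simp only [Set.mem_insert_iff, Set.mem_preimage]
        refine or_congr ⟨fun h => by rw [h, hs0], fun h => ?_⟩ Iff.rfl
        rw [← hss y, h, hs0]
      rw [this]
      exact hclosed.preimage hsc
    · simp only [← hev]
      exact hsc.continuousAt.tendsto.eventually (hopen _ hy)
  rcases hne _ hp with h | h
  · exact h h0
  · exact h h1

/-- On a special quartic, each holomorphic 2-form is a constant multiple of the residue form. -/
lemma exists_const_mul_residueForm (hF : IsSmoothQuartic F) {L : Submodule ℂ V}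
    (hL : IsLineOn F L) {T : V ≃ₗ[ℂ] V} {c : ℂ} {q g : MvPolynomial (Fin 2) ℂ}
    (hT : IsSpecialFrame F L T c q g) {ω : V → V [⋀^Fin 2]→L[ℂ] ℂ}
    (hω : IsHolomorphicTwoForm F ω) :
    ∃ a : ℂ, ∀ v ∈ cone F, ∀ u ∈ tangent F v, ∀ w ∈ tangent F v,
      ω v ![u, w] = a * residueForm F v ![u, w] := by
  obtain ⟨h, hh⟩ := exists_eq_mul_residueForm hF hω
  have hH := fun v hv => exists_analyticAt_eq hF hω hh (v := v) hv
  have hs : ∀ v ∈ cone F, ∀ c : ℂ, c ≠ 0 → h (c • v) = h v := fun v hv c hc =>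
    coefficient_smul hF hω hh hv hc
  have hcont := continuousOn_of_eventually_eq hH
  obtain ⟨l, hlL, hl0⟩ : ∃ v ∈ L, v ≠ 0 := by
    apply Submodule.exists_mem_ne_zero_of_ne_bot
    rintro rfl
    have := hL.1
    simp at this
  have hlc : l ∈ cone F := ⟨hl0, hL.2 l hlL⟩
  -- Subtracting the value on `L` makes a nonzero maximum occur on a level set disjoint from `L`.
  obtain ⟨m, hm, hmax⟩ := exists_forall_norm_le hF ⟨l, hlc⟩ hcont hs (h l)
  have hml : h m = h l := by
    by_contra hne
    refine not_mem_of_isClosed_of_isOpen hT (D := {v | v ∈ cone F ∧ h v = h m})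
      (fun v hv => hv.1) ?_ ?_ ?_ ?_ m ⟨hm, rfl⟩
    · rintro v ⟨hv, hvm⟩ hvL
      exact hne (hvm.symm.trans (eq_of_mem_line hF hL hH hs hvL hv.1 hlL hl0))
    · rintro v ⟨hv, hvm⟩ a ha
      exact ⟨smul_mem_cone hF hv ha, by rw [hs v hv a ha, hvm]⟩
    · rw [← isOpen_compl_iff, isOpen_iff_mem_nhds]
      intro v hv
      simp only [Set.mem_compl_iff, Set.mem_insert_iff, not_or] at hv
      have h0 : ∀ᶠ x in 𝓝 v, x ≠ 0 := isOpen_ne.mem_nhds hv.1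
      by_cases hvF : eval v F = 0
      · have hvc : v ∈ cone F := ⟨hv.1, hvF⟩
        have hvm : h v ≠ h m := fun h' => hv.2 ⟨hvc, h'⟩
        have := eventually_nhdsWithin_iff.1 ((hcont v hvc).eventually_ne hvm)
        filter_upwards [h0, this] with x hx0 hx
        rintro (hx' | hx')
        · exact hx0 hx'
        · exact hx hx'.1 hx'.2
      · filter_upwards [h0, (continuous_eval' F).continuousAt.eventually_ne hvF] with x hx0 hx
        rintro (hx' | hx')
        · exact hx0 hx'
        · exact hx hx'.1.2
    · rintro v ⟨hv, hvm⟩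
      obtain ⟨H, hHa, hHe⟩ := hH v hv
      have := eventually_eq_of_forall_norm_le hF hv hHa hHe (c₀ := h l)
        (fun x hx => by rw [hvm]; exact hmax x hx)
      filter_upwards [this] with x hx hxc
      exact ⟨hxc, (hx hxc).trans hvm⟩
  refine ⟨h l, fun v hv u hu w hw => ?_⟩
  have hvl : h v = h l := by
    have := hmax v hv
    rw [hml, sub_self, norm_zero] at this
    exact sub_eq_zero.1 (norm_le_zero_iff.1 this)
  rw [hh v hv u hu w hw, hvl]

end SpecialForm

/-! ### Symmetries of the surface and linear maps; the symmetry attached to a special line. -/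

section Restriction

open MvPolynomial

variable {F : MvPolynomial (Fin 4) ℂ}

lemma mk_mem_surface (hF : F.IsHomogeneous 4) {v : V} (hv : v ≠ 0) :
    Projectivization.mk ℂ v hv ∈ surface F ↔ eval v F = 0 := by
  simp only [surface, Set.mem_ofPred_eq, Projectivization.submodule_mk]
  refine ⟨fun h => h v (Submodule.mem_span_singleton_self v), fun h w hw => ?_⟩
  obtain ⟨c, rfl⟩ := Submodule.mem_span_singleton.1 hw
  rw [eval_smul_of_isHomogeneous hF, h, mul_zero]

/-- The point of the surface given by a vector of the cone. -/
noncomputable def point (hF : IsSmoothQuartic F) (v : V) (hv : v ∈ cone F) : surface F :=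
  ⟨Projectivization.mk ℂ v hv.1, (mk_mem_surface hF.1 hv.1).2 hv.2⟩

lemma exists_eq_point (hF : IsSmoothQuartic F) (x : surface F) :
    ∃ v, ∃ hv : v ∈ cone F, x = point hF v hv := by
  obtain ⟨x, hx⟩ := x
  induction x using Projectivization.ind with
  | h v hv => exact ⟨v, ⟨hv, (mk_mem_surface hF.1 hv).1 hx⟩, rfl⟩

lemma point_eq_point_iff (hF : IsSmoothQuartic F) {v w : V} (hv : v ∈ cone F) (hw : w ∈ cone F) :
    point hF v hv = point hF w hw ↔ ∃ c : ℂ, c • w = v := by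
  rw [Subtype.ext_iff]
  exact Projectivization.mk_eq_mk_iff' ℂ v w hv.1 hw.1

lemma IsRestriction.map_mem_cone {σ : Equiv.Perm (surface F)} {φ : V ≃ₗ[ℂ] V}
    (hσ : IsRestriction F σ φ) (hF : IsSmoothQuartic F) {v : V} (hv : v ∈ cone F) :
    φ v ∈ cone F := by
  have h1 := hσ (point hF v hv)
  have h2 : φ v ≠ 0 := by simpa using hv.1
  have h3 : (σ (point hF v hv) : ℙ ℂ V) = Projectivization.mk ℂ (φ v) h2 := h1
  refine ⟨h2, (mk_mem_surface hF.1 h2).1 ?_⟩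
  rw [← h3]
  exact (σ _).2

lemma IsRestriction.apply_point {σ : Equiv.Perm (surface F)} {φ : V ≃ₗ[ℂ] V}
    (hσ : IsRestriction F σ φ) (hF : IsSmoothQuartic F) {v : V} (hv : v ∈ cone F) :
    σ (point hF v hv) = point hF (φ v) (hσ.map_mem_cone hF hv) :=
  Subtype.ext (hσ (point hF v hv))

/-- A restriction is the identity only if the linear map is a homothety. -/
lemma IsRestriction.eq_one_iff {σ : Equiv.Perm (surface F)} {φ : V ≃ₗ[ℂ] V}
    (hσ : IsRestriction F σ φ) (hF : IsSmoothQuartic F) :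
    σ = 1 ↔ ∃ μ : ℂ, ∀ v, φ v = μ • v := by
  constructor
  · rintro rfl
    refine exists_eq_smul_of_forall_cone hF φ.toLinearMap fun v hv => ?_
    have h1 := hσ.apply_point hF hv
    obtain ⟨c, hc⟩ := (point_eq_point_iff hF (hσ.map_mem_cone hF hv) hv).1 h1.symm
    exact ⟨c, hc.symm⟩
  · rintro ⟨μ, hμ⟩
    ext1 x
    obtain ⟨v, hv, rfl⟩ := exists_eq_point hF x
    rw [hσ.apply_point hF hv, Equiv.Perm.one_apply, point_eq_point_iff]
    exact ⟨μ, (hμ v).symm⟩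

lemma IsRestriction.mul {σ τ : Equiv.Perm (surface F)} {φ ψ : V ≃ₗ[ℂ] V}
    (hσ : IsRestriction F σ φ) (hτ : IsRestriction F τ ψ) (hF : IsSmoothQuartic F) :
    IsRestriction F (σ * τ) (ψ ≪≫ₗ φ) := by
  intro x
  obtain ⟨v, hv, rfl⟩ := exists_eq_point hF x
  rw [Equiv.Perm.mul_apply, hτ.apply_point hF hv, hσ.apply_point hF]
  rfl

lemma exists_isRestriction (hF : IsSmoothQuartic F) (φ : V ≃ₗ[ℂ] V) {χ : ℂ} (hχ : χ ≠ 0)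
    (h : ∀ v, eval (φ v) F = χ * eval v F) : ∃ σ, IsRestriction F σ φ := by
  have hmem : ∀ (ψ : V ≃ₗ[ℂ] V) (a : ℂ), (∀ v, eval (ψ v) F = a * eval v F) →
      ∀ x ∈ surface F, Projectivization.map ψ.toLinearMap ψ.injective x ∈ surface F := by
    intro ψ a hψ x hx
    induction x using Projectivization.ind with
    | h v hv =>
      rw [Projectivization.map_mk, mk_mem_surface hF.1]
      rw [mk_mem_surface hF.1] at hx
      simpa [hx] using hψ v
  have hsymm : ∀ v, eval (φ.symm v) F = χ⁻¹ * eval v F := by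
    intro v
    have := h (φ.symm v)
    rw [LinearEquiv.apply_symm_apply] at this
    rw [this, inv_mul_cancel_left₀ hχ]
  refine ⟨⟨fun x => ⟨_, hmem φ χ h x x.2⟩, fun x => ⟨_, hmem φ.symm _ hsymm x x.2⟩, ?_, ?_⟩,
    fun x => rfl⟩
  · rintro ⟨x, hx⟩
    induction x using Projectivization.ind with
    | h v hv => simp [Projectivization.map_mk]
  · rintro ⟨x, hx⟩
    induction x using Projectivization.ind with
    | h v hv => simp [Projectivization.map_mk]

/-- As 3 is prime, order 3 means `σ³ = 1` and `σ ≠ 1`; both are read off from homotheties. -/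
lemma IsRestriction.orderOf_eq_three_iff {σ : Equiv.Perm (surface F)} {φ : V ≃ₗ[ℂ] V}
    (hσ : IsRestriction F σ φ) (hF : IsSmoothQuartic F) :
    orderOf σ = 3 ↔ (∃ μ : ℂ, ∀ v, φ (φ (φ v)) = μ • v) ∧ ¬ ∃ μ : ℂ, ∀ v, φ v = μ • v := by
  have h3 : IsRestriction F (σ ^ 3) ((φ ≪≫ₗ φ) ≪≫ₗ φ) := by
    rw [pow_succ', pow_two]
    exact hσ.mul (hσ.mul hσ hF) hF
  rw [← hσ.eq_one_iff hF]
  have h3' := h3.eq_one_iff hF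
  simp only [LinearEquiv.trans_apply] at h3'
  rw [← h3']
  have : Fact (Nat.Prime 3) := ⟨by norm_num⟩
  refine ⟨fun h => ⟨by rw [← h, pow_orderOf_eq_one], ?_⟩, fun h => orderOf_eq_prime h.1 h.2⟩
  rintro rfl
  simp at h

/-- A special line has a symplectic symmetry of order 3. -/
lemma exists_symmetry_of_isSpecialLine (hF : IsSmoothQuartic F) {L : Submodule ℂ V}
    (hL : IsLineOn F L) (h : IsSpecialLine F L) :
    ∃ (σ : Equiv.Perm (surface F)) (φ : V ≃ₗ[ℂ] V), IsRestriction F σ φ ∧ orderOf σ = 3 ∧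
      IsSymplectic F φ ∧ PreservesPlanesThrough L φ := by
  obtain ⟨T, c, q, g, hq, hg, hT⟩ := exists_isSpecialFrame h
  obtain ⟨ζ, hζ⟩ : ∃ ζ : ℂ, IsPrimitiveRoot ζ 3 := ⟨_, Complex.isPrimitiveRoot_exp 3 (by norm_num)⟩
  have hζ3 : ζ ^ 3 = 1 := hζ.pow_eq_one
  have hζ1 : ζ ≠ 1 := hζ.ne_one (by norm_num)
  -- These weights fix `y₂³`, `y₃³` and `y₂y₃`, and their product is `ζ³ = 1`.
  let d : V := ![1, 1, ζ, ζ ^ 2]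
  let d' : V := ![1, 1, ζ ^ 2, ζ]
  have hdd : ∀ i, d i * d' i = 1 := by
    intro i
    fin_cases i <;> simp [d, d'] <;> linear_combination hζ3
  let S : V ≃ₗ[ℂ] V := Matrix.toLin'OfInv (M := Matrix.diagonal d') (M' := Matrix.diagonal d)
    (by simp [Matrix.diagonal_mul_diagonal, mul_comm, hdd])
    (by simp [Matrix.diagonal_mul_diagonal, hdd])
  have hS : ∀ y i, S y i = d i * y i := fun y i =>
    Matrix.mulVec_diagonal d y i
  have hSd : LinearMap.det S.toLinearMap = 1 := by
    have : S.toLinearMap = Matrix.toLin' (Matrix.diagonal d) := rfl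
    rw [this, LinearMap.det_toLin', Matrix.det_diagonal, Fin.prod_univ_four]
    simp only [d, Matrix.cons_val_zero, Matrix.cons_val_one, Matrix.cons_val]
    linear_combination hζ3
  let φ : V ≃ₗ[ℂ] V := (T.symm ≪≫ₗ S) ≪≫ₗ T
  have hφT : ∀ y, φ (T y) = T (S y) := fun y => by simp [φ]
  have hφd : LinearMap.det φ.toLinearMap = 1 := by
    rw [← hSd]
    exact LinearMap.det_conj S.toLinearMap T
  have hφF : ∀ v, eval (φ v) F = 1 * eval v F := by
    intro v
    obtain ⟨y, rfl⟩ := T.surjective v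
    rw [hφT, hT.eval_eq, hT.eval_eq, one_mul, eval_familyZ, eval_familyZ, hS, hS, hS, hS]
    simp only [d, Matrix.cons_val_zero, Matrix.cons_val_one, Matrix.cons_val, one_mul]
    linear_combination c * (y 0 * y 3 ^ 3 * (ζ ^ 3 + 1) + y 1 * y 2 ^ 3 +
      y 2 * y 3 * eval ![y 0, y 1] q) * hζ3
  have hsub : ∀ v, φ v - v ∈ L := by
    intro v
    obtain ⟨y, rfl⟩ := T.surjective v
    rw [hφT, ← map_sub, hT.mem_iff]
    simp [hS, d]
  obtain ⟨σ, hσ⟩ := exists_isRestriction hF φ one_ne_zero hφF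
  refine ⟨σ, φ, hσ, (hσ.orderOf_eq_three_iff hF).2 ⟨⟨1, fun v => ?_⟩, ?_⟩, ?_, ?_⟩
  · obtain ⟨y, rfl⟩ := T.surjective v
    rw [hφT, hφT, hφT, one_smul]
    congr 1
    funext i
    rw [hS, hS, hS]
    fin_cases i <;>
      simp only [d, Fin.zero_eta, Fin.mk_one, Fin.reduceFinMk, Matrix.cons_val_zero,
        Matrix.cons_val_one, Matrix.cons_val]
    · ring
    · ring
    · linear_combination y 2 * hζ3
    · linear_combination y 3 * (ζ ^ 3 + 1) * hζ3
  · rintro ⟨μ, hμ⟩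
    have h1 : ∀ (y : V) i, d i * y i = μ * y i := by
      intro y i
      have := hμ (T y)
      rw [hφT, ← map_smul] at this
      rw [← hS, T.injective this]
      rfl
    have h2 := h1 (fun _ => 1) 0
    have h3 := h1 (fun _ => 1) 2
    simp only [d, Matrix.cons_val_zero, Matrix.cons_val, mul_one] at h2 h3
    exact hζ1 (h3.trans h2.symm)
  · intro ω hω v hv u hu w hw
    obtain ⟨a, ha⟩ := exists_const_mul_residueForm hF hL hT hω
    have := residueForm_map hF φ hφF hv hu hw
    rw [hφd, one_mul, one_mul] at this
    rw [ha _ (map_mem_cone φ hφF hv) _ (map_mem_tangent φ hφF hu) _ (map_mem_tangent φ hφF hw),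
      ha v hv u hu w hw, this]
  · intro H _ hLH
    refine Submodule.eq_of_le_of_finrank_eq ?_ (LinearEquiv.finrank_map_eq φ H)
    rintro _ ⟨v, hv, rfl⟩
    have : φ v = (φ v - v) + v := by abel
    rw [LinearEquiv.coe_coe, this]
    exact H.add_mem (hLH (hsub v)) hv

end Restriction

end QuarticSurface

namespace QuarticSurface

/-! ### Eigenvector frames adapted to the line. -/

section Frames

open MvPolynomial

variable {F : MvPolynomial (Fin 4) ℂ} {L : Submodule ℂ V}

lemma isSpecialLine_of_isSpecialFrame {T : V ≃ₗ[ℂ] V} {c : ℂ} {q g : MvPolynomial (Fin 2) ℂ}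
    (hq : q.IsHomogeneous 2) (hg : g.IsHomogeneous 4) (hT : IsSpecialFrame F L T c q g) :
    IsSpecialLine F L := by
  let A : GL (Fin 4) ℂ :=
    ⟨LinearMap.toMatrix' T.symm.toLinearMap, LinearMap.toMatrix' T.toLinearMap,
      by rw [← LinearMap.toMatrix'_comp]; simp, by rw [← LinearMap.toMatrix'_comp]; simp⟩
  have hA : ∀ v i, eval v (newCoord A i) = T.symm v i := by
    intro v i
    rw [eval_newCoord]
    exact congrFun (LinearMap.toMatrix'_mulVec T.symm.toLinearMap v) i
  refine ⟨A, fun v => ?_, c, q, g, hT.ne_zero, hq, hg, MvPolynomial.funext fun v => ?_⟩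
  · rw [hA, hA, ← hT.mem_iff, LinearEquiv.apply_symm_apply]
  · rw [map_mul, eval_C, eval_bind₁]
    simp only [hA]
    rw [← hT.eval_eq, LinearEquiv.apply_symm_apply]

/-- An endomorphism of order 3 has an eigenvector in `M` outside of `N`, if `M` is invariant and
not contained in `N`. -/
lemma exists_eigenvector_not_mem {ψ : V →ₗ[ℂ] V} (hψ : ∀ v, ψ (ψ (ψ v)) = v)
    {M N : Submodule ℂ V} (hM : ∀ v ∈ M, ψ v ∈ M) (hMN : ¬ M ≤ N) :
    ∃ w ∈ M, w ∉ N ∧ ∃ a : ℂ, a ^ 3 = 1 ∧ ψ w = a • w := by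
  obtain ⟨ζ, hζ⟩ : ∃ ζ : ℂ, IsPrimitiveRoot ζ 3 := ⟨_, Complex.isPrimitiveRoot_exp 3 (by norm_num)⟩
  have hζ3 : ζ ^ 3 = 1 := hζ.pow_eq_one
  have hζs : 1 + ζ + ζ ^ 2 = 0 := by
    have h1 : (ζ - 1) * (1 + ζ + ζ ^ 2) = 0 := by linear_combination hζ3
    exact (mul_eq_zero.1 h1).resolve_left (sub_ne_zero.2 (hζ.ne_one (by norm_num)))
  obtain ⟨x, hxM, hxN⟩ := SetLike.not_le_iff_exists.1 hMN
  by_contra! hcon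
  -- This vector is three times the `a`-eigencomponent of `x`. Over the three cube roots of unity
  -- they add up to `3x`, so they cannot all lie in `N`.
  have key : ∀ a : ℂ, a ^ 3 = 1 → x + a ^ 2 • ψ x + a • ψ (ψ x) ∈ N := by
    intro a ha
    by_contra hn
    refine hcon _ (M.add_mem (M.add_mem hxM (M.smul_mem _ (hM x hxM)))
      (M.smul_mem _ (hM _ (hM x hxM)))) hn a ha ?_
    simp only [map_add, map_smul, hψ, smul_add, smul_smul]
    rw [show a * a ^ 2 = 1 by linear_combination ha]
    module
  have h1 := key 1 (by norm_num)
  have h2 := key ζ hζ3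
  have h3 := key (ζ ^ 2) (by linear_combination (ζ ^ 3 + 1) * hζ3)
  have h4 := N.smul_mem (1 / 3) (N.add_mem (N.add_mem h1 h2) h3)
  apply hxN
  have e1 : (1 : ℂ) ^ 2 + ζ ^ 2 + (ζ ^ 2) ^ 2 = 0 := by linear_combination hζs + ζ * hζ3
  have : x + (1 : ℂ) ^ 2 • ψ x + (1 : ℂ) • ψ (ψ x) + (x + ζ ^ 2 • ψ x + ζ • ψ (ψ x)) +
      (x + (ζ ^ 2) ^ 2 • ψ x + ζ ^ 2 • ψ (ψ x)) =
      (3 : ℂ) • x + ((1 : ℂ) ^ 2 + ζ ^ 2 + (ζ ^ 2) ^ 2) • ψ x + (1 + ζ + ζ ^ 2) • ψ (ψ x) := by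
    module
  rw [this, e1, hζs] at h4
  have h5 : (1 / 3 : ℂ) • ((3 : ℂ) • x + (0 : ℂ) • ψ x + (0 : ℂ) • ψ (ψ x)) = x := by module
  rwa [h5] at h4

/-- A frame of eigenvectors adapted to an invariant line. -/
lemma exists_eigenframe (hL : Module.finrank ℂ L = 2) {ψ : V →ₗ[ℂ] V}
    (hψ : ∀ v, ψ (ψ (ψ v)) = v) (hψL : ∀ v ∈ L, ψ v ∈ L) :
    ∃ (T : V ≃ₗ[ℂ] V) (d : V), (∀ y, T y ∈ L ↔ y 0 = 0 ∧ y 1 = 0) ∧ (∀ i, d i ^ 3 = 1) ∧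
      ∀ y, ψ (T y) = T (fun i => d i * y i) := by
  have hspan : ∀ x : V, Module.finrank ℂ (Submodule.span ℂ {x}) ≤ 1 := fun x => by
    simpa using finrank_span_le_card (R := ℂ) ({x} : Set V)
  obtain ⟨u₃, hu₃, hu₃0, a₃, ha₃, he₃⟩ := exists_eigenvector_not_mem hψ (N := ⊥) hψL (by
    intro h
    rw [le_bot_iff.1 h] at hL
    simp at hL)
  obtain ⟨u₂, hu₂, hu₂0, a₂, ha₂, he₂⟩ :=
    exists_eigenvector_not_mem hψ (N := Submodule.span ℂ {u₃}) hψL (by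
      intro h
      have h1 := Submodule.finrank_mono h
      have h2 := hspan u₃
      omega)
  obtain ⟨u₁, -, hu₁0, a₁, ha₁, he₁⟩ :=
    exists_eigenvector_not_mem hψ (M := ⊤) (N := L) (fun _ _ => trivial) (by
      intro h
      have h1 := Submodule.finrank_mono h
      rw [finrank_top, Module.finrank_fin_fun] at h1
      omega)
  obtain ⟨u₀, -, hu₀0, a₀, ha₀, he₀⟩ :=
    exists_eigenvector_not_mem hψ (M := ⊤) (N := L ⊔ Submodule.span ℂ {u₁})
      (fun _ _ => trivial) (by
      intro h
      have h1 := Submodule.finrank_mono h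
      have h2 := Submodule.finrank_add_le_finrank_add_finrank L (Submodule.span ℂ {u₁})
      have h3 := hspan u₁
      rw [finrank_top, Module.finrank_fin_fun] at h1
      omega)
  have hle : Submodule.span ℂ (Set.range ![u₂, u₃]) ≤ L := by
    rw [Submodule.span_le]
    rintro _ ⟨i, rfl⟩
    fin_cases i
    · exact hu₂
    · exact hu₃
  have hi1 : LinearIndependent ℂ ![u₃] := by
    rw [linearIndependent_unique_iff]
    simpa using hu₃0
  have hi2 : LinearIndependent ℂ ![u₂, u₃] :=
    linearIndependent_finCons.2 ⟨hi1, by simpa using hu₂0⟩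
  have hi3 : LinearIndependent ℂ ![u₁, u₂, u₃] :=
    linearIndependent_finCons.2 ⟨hi2, fun h => hu₁0 (hle h)⟩
  have hi4 : LinearIndependent ℂ ![u₀, u₁, u₂, u₃] := by
    refine linearIndependent_finCons.2 ⟨hi3, fun h => hu₀0 ?_⟩
    refine (Submodule.span_le.2 ?_ : _ ≤ L ⊔ Submodule.span ℂ {u₁}) h
    rintro _ ⟨i, rfl⟩
    fin_cases i
    · exact Submodule.mem_sup_right (Submodule.mem_span_singleton_self u₁)
    · exact Submodule.mem_sup_left hu₂
    · exact Submodule.mem_sup_left hu₃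
  have hspanL : Submodule.span ℂ (Set.range ![u₂, u₃]) = L :=
    Submodule.eq_of_le_of_finrank_eq hle (by rw [finrank_span_eq_card hi2, hL]; simp)
  let b := basisOfLinearIndependentOfCardEqFinrank hi4 (by simp)
  have hb : ⇑b = ![u₀, u₁, u₂, u₃] := coe_basisOfLinearIndependentOfCardEqFinrank hi4 _
  let T : V ≃ₗ[ℂ] V := b.equivFun.symm
  have hT : ∀ y, T y = y 0 • u₀ + y 1 • u₁ + y 2 • u₂ + y 3 • u₃ := by
    intro y
    simp only [T, Module.Basis.equivFun_symm_apply, hb, Fin.sum_univ_four, Matrix.cons_val_zero,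
      Matrix.cons_val_one, Matrix.cons_val]
  refine ⟨T, ![a₀, a₁, a₂, a₃], fun y => ⟨fun h => ?_, fun h => ?_⟩, fun i => ?_, fun y => ?_⟩
  · rw [← hspanL, Submodule.mem_span_range_iff_exists_fun] at h
    obtain ⟨c, hc⟩ := h
    have : T ![0, 0, c 0, c 1] = T y := by
      rw [hT, ← hc]
      simp
    rw [← T.injective this]
    simp
  · rw [hT, h.1, h.2]
    simpa using L.add_mem (L.smul_mem (y 2) hu₂) (L.smul_mem (y 3) hu₃)
  · fin_cases i
    · exact ha₀
    · exact ha₁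
    · exact ha₂
    · exact ha₃
  · rw [hT, hT]
    simp only [map_add, map_smul, he₀, he₁, he₂, he₃, smul_smul, Matrix.cons_val_zero,
      Matrix.cons_val_one, Matrix.cons_val, mul_comm]

/-- If all planes through a line are preserved, then the map is a homothety modulo the line. -/
lemma exists_sub_smul_mem (hL : Module.finrank ℂ L = 2) {φ : V ≃ₗ[ℂ] V}
    (hφ : PreservesPlanesThrough L φ) : ∃ c : ℂ, ∀ v, φ v - c • v ∈ L := by
  -- With the identity map, this merely provides coordinates in which `L` is `y₀ = y₁ = 0`.
  obtain ⟨T, -, hT, -, -⟩ := exists_eigenframe hL (ψ := LinearMap.id) (fun _ => rfl)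
    (fun _ h => h)
  let ψ : V →ₗ[ℂ] V := (T.symm.toLinearMap ∘ₗ φ.toLinearMap) ∘ₗ T.toLinearMap
  have hψ : ∀ y, T (ψ y) = φ (T y) := fun y => by simp [ψ]
  have key : ∀ a b : ℂ, (a, b) ≠ 0 → ∀ y : V, a * y 0 + b * y 1 = 0 →
      a * ψ y 0 + b * ψ y 1 = 0 := by
    intro a b hab y hy
    let f : Module.Dual ℂ V := a • LinearMap.proj 0 + b • LinearMap.proj 1
    have hf : ∀ y, f y = a * y 0 + b * y 1 := fun y => rfl
    have hf0 : f ≠ 0 := by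
      intro h0
      apply hab
      have h1 := LinearMap.congr_fun h0 (Pi.single 0 1)
      have h2 := LinearMap.congr_fun h0 (Pi.single 1 1)
      simp [hf] at h1 h2
      rw [h1, h2]
      rfl
    let H : Submodule ℂ V := (LinearMap.ker f).map T.toLinearMap
    have hH : Module.finrank ℂ H = 3 := by
      have h1 := Module.Dual.finrank_ker_add_one_of_ne_zero hf0
      rw [Module.finrank_fin_fun] at h1
      have h2 : Module.finrank ℂ H = _ := LinearEquiv.finrank_map_eq T (LinearMap.ker f)
      omega
    have hLH : L ≤ H := by
      intro v hv
      obtain ⟨z, rfl⟩ := T.surjective v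
      rw [hT] at hv
      refine ⟨z, ?_, rfl⟩
      simp [hf, hv.1, hv.2]
    have h1 : φ (T y) ∈ H.map φ.toLinearMap := ⟨T y, ⟨y, hy, rfl⟩, rfl⟩
    rw [hφ H hH hLH, ← hψ] at h1
    obtain ⟨z, hz, hzy⟩ := h1
    rw [← T.injective hzy]
    exact hz
  have h0 : ∀ y : V, y 0 = 0 → ψ y 0 = 0 := fun y hy => by
    simpa using key 1 0 (by simp) y (by simp [hy])
  have h1 : ∀ y : V, y 1 = 0 → ψ y 1 = 0 := fun y hy => by
    simpa using key 0 1 (by simp) y (by simp [hy])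
  let e₀ : V := Pi.single 0 1
  let e₁ : V := Pi.single 1 1
  -- The planes `y₀ = 0` and `y₁ = 0` make the map diagonal modulo `L`; the plane `y₀ = y₁` makes
  -- its two entries equal.
  have h2 : ψ e₁ 1 = ψ e₀ 0 := by
    have h3 := key 1 (-1) (by simp) (e₀ + e₁) (by simp [e₀, e₁])
    have h4 := h0 e₁ (by simp [e₁])
    have h5 := h1 e₀ (by simp [e₀])
    rw [map_add, Pi.add_apply, Pi.add_apply, h4, h5] at h3
    linear_combination -h3
  refine ⟨ψ e₀ 0, fun v => ?_⟩
  obtain ⟨y, rfl⟩ := T.surjective v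
  rw [← hψ, ← map_smul, ← map_sub, hT]
  have h3 := h0 (y - y 0 • e₀) (by simp [e₀])
  have h4 := h1 (y - y 1 • e₁) (by simp [e₁])
  rw [map_sub, map_smul] at h3 h4
  simp only [Pi.sub_apply, Pi.smul_apply, smul_eq_mul] at h3 h4 ⊢
  rw [h2] at h4
  exact ⟨by linear_combination h3, by linear_combination h4⟩

end Frames

/-! ### Quartic forms invariant under `diag(1, 1, ζ, ζ²)`. -/

section Decomposition

open MvPolynomial

/-- A diagonal substitution scales each monomial separately, so invariance becomes a condition on
exponents. -/
lemma coeff_bind₁_C_mul_X {σ : Type*} [Fintype σ] (d : σ → ℂ) (P : MvPolynomial σ ℂ)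
    (m : σ →₀ ℕ) :
    coeff m (bind₁ (fun i => C (d i) * X i) P) = (∏ i, d i ^ m i) * coeff m P := by
  classical
  induction P using MvPolynomial.induction_on' with
  | monomial u a =>
    have : bind₁ (fun i => C (d i) * X i) (monomial u a) =
        C (∏ i, d i ^ u i) * monomial u a := by
      rw [bind₁_monomial, monomial_eq, map_prod, ← mul_assoc, mul_comm (∏ _, _), mul_assoc]
      congr 1
      simp only [mul_pow, Finset.prod_mul_distrib, Finsupp.prod, ← map_pow]
      congr 1
      refine Finset.prod_subset (Finset.subset_univ _) fun i _ hi => ?_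
      rw [Finsupp.notMem_support_iff.1 hi, pow_zero, map_one]
    rw [this, coeff_C_mul, coeff_monomial]
    split_ifs with h
    · rw [h]
    · simp
  | add p q hp hq => rw [map_add, coeff_add, coeff_add, hp, hq, mul_add]

/-- The coefficient of `X₂ⁱX₃ʲ` in a polynomial in four variables. -/
noncomputable def coeffPart (P : MvPolynomial (Fin 4) ℂ) (k : ℕ × ℕ) : MvPolynomial (Fin 2) ℂ :=
  ∑ m ∈ P.support with (m 2, m 3) = k, C (coeff m P) * (X 0 ^ m 0 * X 1 ^ m 1)

lemma isHomogeneous_coeffPart {P : MvPolynomial (Fin 4) ℂ} (hP : P.IsHomogeneous 4) {i j n : ℕ}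
    (hn : n + i + j = 4) : (coeffPart P (i, j)).IsHomogeneous n := by
  refine IsHomogeneous.sum _ _ _ fun m hm => ?_
  rw [Finset.mem_filter, Prod.mk.injEq, mem_support_iff] at hm
  have h1 := hP hm.1
  rw [Finsupp.weight_apply, Finsupp.sum_fintype _ _ (by simp), Fin.sum_univ_four] at h1
  simp only [Pi.one_apply, smul_eq_mul, mul_one] at h1
  have h2 : n = m 0 + m 1 := by omega
  rw [h2]
  exact ((isHomogeneous_X_pow 0 _).mul (isHomogeneous_X_pow 1 _)).C_mul _

lemma eval_eq_sum_coeffPart {P : MvPolynomial (Fin 4) ℂ} {K : Finset (ℕ × ℕ)}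
    (hK : ∀ m ∈ P.support, (m 2, m 3) ∈ K) (y : V) :
    eval y P = ∑ k ∈ K, y 2 ^ k.1 * y 3 ^ k.2 * eval ![y 0, y 1] (coeffPart P k) := by
  rw [eval_eq', ← Finset.sum_fiberwise_of_maps_to hK]
  refine Finset.sum_congr rfl fun k _ => ?_
  rw [coeffPart, map_sum, Finset.mul_sum]
  refine Finset.sum_congr rfl fun m hm => ?_
  rw [← (Finset.mem_filter.1 hm).2, Fin.prod_univ_four]
  simp
  ring

lemma eval_eq_of_isHomogeneous_one {ℓ : MvPolynomial (Fin 2) ℂ} (h : ℓ.IsHomogeneous 1) :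
    ∃ a b : ℂ, ∀ y, eval y ℓ = a * y 0 + b * y 1 := by
  refine ⟨eval 0 (pderiv 0 ℓ), eval 0 (pderiv 1 ℓ), fun y => ?_⟩
  have h1 := congrArg (eval y) h.sum_X_mul_pderiv
  have h2 : ∀ i, eval y (pderiv i ℓ) = eval 0 (pderiv i ℓ) := fun i => by
    have := eval_smul_of_isHomogeneous (n := 0) h.pderiv 0 y (P := pderiv i ℓ)
    rw [zero_smul] at this
    simpa using this.symm
  simp only [Fin.sum_univ_two, map_add, map_mul, eval_X, h2, one_smul] at h1
  rw [← h1]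
  ring

/-- A quartic form that is invariant under `diag(1, 1, ζ, ζ²)` and vanishes on
`y₀ = y₁ = 0`. -/
lemma exists_decomposition {P : MvPolynomial (Fin 4) ℂ} (hP : P.IsHomogeneous 4) {ζ : ℂ}
    (hζ : IsPrimitiveRoot ζ 3)
    (hinv : ∀ y : V, eval ![y 0, y 1, ζ * y 2, ζ ^ 2 * y 3] P = eval y P)
    (hzero : eval ![0, 0, 1, 1] P = 0) :
    ∃ (q g : MvPolynomial (Fin 2) ℂ) (a b a' b' : ℂ), q.IsHomogeneous 2 ∧ g.IsHomogeneous 4 ∧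
      ∀ y : V, eval y P = (a * y 0 + b * y 1) * y 3 ^ 3 + (a' * y 0 + b' * y 1) * y 2 ^ 3 +
        y 2 * y 3 * eval ![y 0, y 1] q + eval ![y 0, y 1] g := by
  have hP' : bind₁ (fun i => C ((![1, 1, ζ, ζ ^ 2] : V) i) * X i) P = P := by
    refine MvPolynomial.funext fun y => ?_
    rw [eval_bind₁, ← hinv y]
    congr 2
    funext i
    fin_cases i <;> simp
  -- Invariance means `i + 2j ≡ 0 (mod 3)` for `y₂ⁱy₃ʲ`; with `i + j ≤ 4` only five pairs remain.
  have hK : ∀ m ∈ P.support,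
      (m 2, m 3) ∈ ({(0, 0), (1, 1), (3, 0), (0, 3), (2, 2)} : Finset (ℕ × ℕ)) := by
    intro m hm
    rw [mem_support_iff] at hm
    have h1 := coeff_bind₁_C_mul_X ![1, 1, ζ, ζ ^ 2] P m
    rw [hP', Fin.prod_univ_four] at h1
    simp only [Matrix.cons_val_zero, Matrix.cons_val_one, Matrix.cons_val, one_pow, one_mul,
      ← pow_mul, ← pow_add] at h1
    have h2 : ζ ^ (m 2 + 2 * m 3) = 1 := by
      apply mul_right_cancel₀ hm
      rw [one_mul, ← h1]
    have h3 := hζ.dvd_of_pow_eq_one _ h2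
    have h4 := hP hm
    rw [Finsupp.weight_apply, Finsupp.sum_fintype _ _ (by simp), Fin.sum_univ_four] at h4
    simp only [Pi.one_apply, smul_eq_mul, mul_one] at h4
    simp only [Finset.mem_insert, Finset.mem_singleton, Prod.mk.injEq]
    generalize m 2 = i at *
    generalize m 3 = j at *
    have h5 : j ≤ 4 := by omega
    clear h1 h2
    interval_cases j <;> omega
  have hev : ∀ y : V, eval y P = eval ![y 0, y 1] (coeffPart P (0, 0)) +
      (y 2 * y 3 * eval ![y 0, y 1] (coeffPart P (1, 1)) +
      (y 2 ^ 3 * eval ![y 0, y 1] (coeffPart P (3, 0)) +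
      (y 3 ^ 3 * eval ![y 0, y 1] (coeffPart P (0, 3)) +
      y 2 ^ 2 * y 3 ^ 2 * eval ![y 0, y 1] (coeffPart P (2, 2))))) := by
    intro y
    rw [eval_eq_sum_coeffPart hK, Finset.sum_insert (by decide), Finset.sum_insert (by decide),
      Finset.sum_insert (by decide), Finset.sum_insert (by decide), Finset.sum_singleton]
    ring
  have hg := isHomogeneous_coeffPart hP (i := 0) (j := 0) (n := 4) rfl
  have hq := isHomogeneous_coeffPart hP (i := 1) (j := 1) (n := 2) rfl
  obtain ⟨a', b', hab'⟩ := eval_eq_of_isHomogeneous_one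
    (isHomogeneous_coeffPart hP (i := 3) (j := 0) (n := 1) rfl)
  obtain ⟨a, b, hab⟩ := eval_eq_of_isHomogeneous_one
    (isHomogeneous_coeffPart hP (i := 0) (j := 3) (n := 1) rfl)
  have he := isHomogeneous_coeffPart hP (i := 2) (j := 2) (n := 0) rfl
  have hz : ∀ {n : ℕ} {Q : MvPolynomial (Fin 2) ℂ}, Q.IsHomogeneous n → ∀ y : Fin 2 → ℂ,
      eval 0 Q = 0 ^ n * eval y Q := by
    intro n Q hQ y
    rw [← eval_smul_of_isHomogeneous hQ, zero_smul]
  have h0 : (![0, 0] : Fin 2 → ℂ) = 0 := by simp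
  -- At `(0, 0, 1, 1)` only the constant coefficient of `y₂²y₃²` survives.
  have he0 : eval 0 (coeffPart P (2, 2)) = 0 := by
    have := hev ![0, 0, 1, 1]
    simp only [Matrix.cons_val_zero, Matrix.cons_val_one, Matrix.cons_val, hzero, hab, hab',
      h0] at this
    rw [hz hg 0, hz hq 0] at this
    simpa using this.symm
  refine ⟨_, _, a, b, a', b', hq, hg, fun y => ?_⟩
  have he1 := hz he ![y 0, y 1]
  rw [he0, pow_zero, one_mul] at he1
  rw [hev, hab, hab', ← he1]
  simp only [Matrix.cons_val_zero, Matrix.cons_val_one]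
  ring

end Decomposition

end QuarticSurface

namespace QuarticSurface

/-! ### From a symplectic symmetry to the special equation. -/

section Converse

open MvPolynomial

variable {F : MvPolynomial (Fin 4) ℂ} {L : Submodule ℂ V}

/-- Smoothness along the line `y₀ = y₁ = 0`. -/
lemma det_ne_zero_of_decomposition (hF : IsSmoothQuartic F) (hL : IsLineOn F L) {T : V ≃ₗ[ℂ] V}
    (hT : ∀ y, T y ∈ L ↔ y 0 = 0 ∧ y 1 = 0) {q g : MvPolynomial (Fin 2) ℂ}
    (hq : q.IsHomogeneous 2) (hg : g.IsHomogeneous 4) {a b a' b' : ℂ}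
    (h : ∀ y : V, eval (T y) F = (a * y 0 + b * y 1) * y 3 ^ 3 +
      (a' * y 0 + b' * y 1) * y 2 ^ 3 + y 2 * y 3 * eval ![y 0, y 1] q + eval ![y 0, y 1] g) :
    a * b' - b * a' ≠ 0 := by
  intro hdet
  obtain ⟨x, z, hxz, hx1, hx2⟩ : ∃ x z : ℂ, (x ≠ 0 ∨ z ≠ 0) ∧ a * x + a' * z = 0 ∧
      b * x + b' * z = 0 := by
    by_cases h1 : a = 0 ∧ a' = 0
    · by_cases h2 : b = 0 ∧ b' = 0
      · exact ⟨1, 0, by simp, by simp [h1.1], by simp [h2.1]⟩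
      · refine ⟨b', -b, ?_, by rw [h1.1, h1.2]; ring, by ring⟩
        rw [neg_ne_zero]
        tauto
    · refine ⟨a', -a, ?_, by ring, by linear_combination -hdet⟩
      rw [neg_ne_zero]
      tauto
  -- Cube roots of a linear relation between the two coefficient forms give a point `(0, 0, s, t)`
  -- of the line at which `dF` vanishes.
  obtain ⟨t, ht⟩ := IsAlgClosed.exists_pow_nat_eq x (n := 3) (by norm_num)
  obtain ⟨s, hs⟩ := IsAlgClosed.exists_pow_nat_eq z (n := 3) (by norm_num)
  let y : V := ![0, 0, s, t]
  have hy0 : y ≠ 0 := by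
    intro h0
    have h2 : s = 0 := by simpa [y] using congrFun h0 2
    have h3 : t = 0 := by simpa [y] using congrFun h0 3
    rw [h2] at hs
    rw [h3] at ht
    simp [← hs, ← ht] at hxz
  have hyL : T y ∈ L := by simp [hT, y]
  have hyc : T y ∈ cone F := ⟨by simpa using hy0, hL.2 _ hyL⟩
  have hquad : ∀ α β τ : ℂ, eval ![τ * α, τ * β] q = τ ^ 2 * eval ![α, β] q := by
    intro α β τ
    rw [← eval_smul_of_isHomogeneous hq]
    simp
  have hquart : ∀ α β τ : ℂ, eval ![τ * α, τ * β] g = τ ^ 4 * eval ![α, β] g := by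
    intro α β τ
    rw [← eval_smul_of_isHomogeneous hg]
    simp
  apply diffForm_ne_zero hF hyc
  refine LinearMap.ext fun v => ?_
  obtain ⟨w, rfl⟩ := T.surjective v
  have hsplit : T w = T ![w 0, w 1, 0, 0] + T ![0, 0, w 2, w 3] := by
    rw [← map_add]
    congr 1
    funext i
    fin_cases i <;> simp
  rw [hsplit, map_add, diffForm_eq_zero_of_mem (w := T ![0, 0, w 2, w 3]) hL.2 hyL (by simp [hT]),
    add_zero,
    LinearMap.zero_apply]
  refine (hasDerivAt_eval_line F (T y) (T ![w 0, w 1, 0, 0])).unique ?_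
  have hpoly : ∀ τ : ℂ, eval (T y + τ • T ![w 0, w 1, 0, 0]) F =
      τ ^ 2 * (s * t * eval ![w 0, w 1] q) + τ ^ 4 * eval ![w 0, w 1] g := by
    intro τ
    rw [← map_smul, ← map_add, h]
    simp only [y, Pi.add_apply, Pi.smul_apply, Matrix.cons_val_zero, Matrix.cons_val_one,
      Matrix.cons_val, smul_eq_mul, mul_zero, zero_add, add_zero, hquad, hquart, ht, hs]
    linear_combination τ * w 0 * hx1 + τ * w 1 * hx2
  have hd : HasDerivAt (fun τ : ℂ => τ ^ 2 * (s * t * eval ![w 0, w 1] q) +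
      τ ^ 4 * eval ![w 0, w 1] g) 0 0 := by
    exact (((hasDerivAt_pow 2 (0 : ℂ)).mul_const (s * t * eval ![w 0, w 1] q)).add
      ((hasDerivAt_pow 4 (0 : ℂ)).mul_const (eval ![w 0, w 1] g))).congr_deriv (by simp)
  exact hd.congr_of_eventuallyEq (Filter.Eventually.of_forall hpoly)

/-- The change of coordinates `(a y₀ + b y₁, a' y₀ + b' y₁, y₂, y₃)`. -/
noncomputable def firstCoordsEquiv (a b a' b' : ℂ) (h : a * b' - b * a' ≠ 0) : V ≃ₗ[ℂ] V where
  toFun y := ![a * y 0 + b * y 1, a' * y 0 + b' * y 1, y 2, y 3]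
  map_add' y z := by
    funext i
    fin_cases i <;> simp <;> ring
  map_smul' c y := by
    funext i
    fin_cases i <;> simp <;> ring
  invFun y := ![(a * b' - b * a')⁻¹ * (b' * y 0 - b * y 1),
    (a * b' - b * a')⁻¹ * (a * y 1 - a' * y 0), y 2, y 3]
  left_inv y := by
    have hD := inv_mul_cancel₀ h
    funext i
    fin_cases i <;> simp
    · linear_combination y 0 * hD
    · linear_combination y 1 * hD
  right_inv y := by
    have hD := inv_mul_cancel₀ h
    funext i
    fin_cases i <;> simp
    · linear_combination y 0 * hD
    · linear_combination y 1 * hD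

lemma isSpecialLine_of_decomposition (hF : IsSmoothQuartic F) (hL : IsLineOn F L)
    {T : V ≃ₗ[ℂ] V} (hT : ∀ y, T y ∈ L ↔ y 0 = 0 ∧ y 1 = 0) {q g : MvPolynomial (Fin 2) ℂ}
    (hq : q.IsHomogeneous 2) (hg : g.IsHomogeneous 4) {a b a' b' : ℂ}
    (h : ∀ y : V, eval (T y) F = (a * y 0 + b * y 1) * y 3 ^ 3 +
      (a' * y 0 + b' * y 1) * y 2 ^ 3 + y 2 * y 3 * eval ![y 0, y 1] q + eval ![y 0, y 1] g) :
    IsSpecialLine F L := by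
  have hdet := det_ne_zero_of_decomposition hF hL hT hq hg h
  set N := firstCoordsEquiv a b a' b' hdet with hN
  set D : ℂ := (a * b' - b * a')⁻¹ with hD
  have hNapp : ∀ y, N y = ![a * y 0 + b * y 1, a' * y 0 + b' * y 1, y 2, y 3] := fun y => rfl
  -- The inverse of `N` on the first two coordinates, used to rewrite `q` and `g`.
  let s : Fin 2 → MvPolynomial (Fin 2) ℂ :=
    ![C (D * b') * X 0 + C (-(D * b)) * X 1, C (-(D * a')) * X 0 + C (D * a) * X 1]
  have hs : ∀ i, (s i).IsHomogeneous 1 := by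
    intro i
    fin_cases i <;>
      exact ((isHomogeneous_X _ _).C_mul _).add ((isHomogeneous_X _ _).C_mul _)
  have hev : ∀ (Q : MvPolynomial (Fin 2) ℂ) (y : V),
      eval ![N y 0, N y 1] (aeval s Q) = eval ![y 0, y 1] Q := by
    intro Q y
    rw [aeval_eq_bind₁, eval_bind₁]
    congr 2
    have hD' : D * (a * b' - b * a') = 1 := inv_mul_cancel₀ hdet
    funext i
    fin_cases i
    · simp [s, hNapp]
      linear_combination y 0 * hD'
    · simp [s, hNapp]
      linear_combination y 1 * hD'
  refine isSpecialLine_of_isSpecialFrame (T := N.symm ≪≫ₗ T) (c := 1) (q := aeval s q)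
    (g := aeval s g) (by simpa using hq.aeval s hs) (by simpa using hg.aeval s hs)
    ⟨one_ne_zero, fun y => ?_, fun y => ?_⟩
  · obtain ⟨z, rfl⟩ := N.surjective y
    rw [LinearEquiv.trans_apply, LinearEquiv.symm_apply_apply, hT, hNapp]
    simp only [Matrix.cons_val_zero, Matrix.cons_val_one]
    constructor
    · rintro ⟨h0, h1⟩
      simp [h0, h1]
    · rintro ⟨h0, h1⟩
      constructor
      · apply mul_left_cancel₀ hdet
        linear_combination b' * h0 - b * h1
      · apply mul_left_cancel₀ hdet
        linear_combination a * h1 - a' * h0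
  · obtain ⟨z, rfl⟩ := N.surjective y
    rw [LinearEquiv.trans_apply, LinearEquiv.symm_apply_apply, h, eval_familyZ, hev, hev, hNapp]
    simp only [Matrix.cons_val_zero, Matrix.cons_val_one, Matrix.cons_val]
    ring

/-- A line is special if there is a linear map of order 3 that preserves the quartic form up to
its determinant and acts trivially modulo the line. -/
lemma isSpecialLine_of_linearMap (hF : IsSmoothQuartic F) (hL : IsLineOn F L) {ψ : V →ₗ[ℂ] V}
    (hψ3 : ∀ v, ψ (ψ (ψ v)) = v) (hψ1 : ∃ v, ψ v ≠ v) (hψL : ∀ v, ψ v - v ∈ L)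
    (hψF : ∀ v, eval (ψ v) F = LinearMap.det ψ * eval v F) : IsSpecialLine F L := by
  obtain ⟨T, d, hT, hd3, hTd⟩ := exists_eigenframe hL.1 hψ3
    (fun v hv => by simpa using L.add_mem (hψL v) hv)
  have hd01 : d 0 = 1 ∧ d 1 = 1 := by
    have := hψL (T fun _ => 1)
    rw [hTd, ← map_sub, hT] at this
    simpa [sub_eq_zero] using this
  have hdet : LinearMap.det ψ = d 2 * d 3 := by
    have h1 : ψ = T.toLinearMap ∘ₗ Matrix.toLin' (Matrix.diagonal d) ∘ₗ T.symm.toLinearMap := by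
      refine LinearMap.ext fun v => ?_
      obtain ⟨y, rfl⟩ := T.surjective v
      rw [hTd]
      simp only [LinearMap.comp_apply, LinearEquiv.coe_coe, LinearEquiv.symm_apply_apply,
        Matrix.toLin'_apply]
      congr 1
      funext i
      rw [Matrix.mulVec_diagonal]
    rw [h1, LinearMap.det_conj, LinearMap.det_toLin', Matrix.det_diagonal, Fin.prod_univ_four,
      hd01.1, hd01.2]
    ring
  let e : Fin 4 → V := fun i => T (Pi.single i 1)
  have he : ∀ i, ψ (e i) = d i • e i := by
    intro i
    simp only [e]
    rw [hTd, ← map_smul]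
    congr 1
    funext j
    by_cases hij : j = i
    · subst hij; simp
    · simp [hij]
  have he2 : e 2 ∈ L := by simp [e, hT]
  have he3 : e 3 ∈ L := by simp [e, hT]
  have he2c : e 2 ∈ cone F := ⟨by simp [e], hL.2 _ he2⟩
  -- Since `F` vanishes on `L`, smoothness at `e 2` gives `dF(e 2)(e i) ≠ 0` with `i` equal to 0 or
  -- 1. Equivariance multiplies this value by `(d 2)³ · 1 = 1` and by `det ψ = d 2 * d 3`.
  have hχ : d 2 * d 3 = 1 := by
    obtain ⟨i, hi⟩ : ∃ i, diffForm F (e 2) (e i) ≠ 0 := by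
      by_contra! hcon
      apply diffForm_ne_zero hF he2c
      have h1 : diffForm F (e 2) ∘ₗ T.toLinearMap = 0 :=
        LinearMap.pi_ext' fun i => LinearMap.ext_ring (by simpa [e] using hcon i)
      refine LinearMap.ext fun v => ?_
      obtain ⟨y, rfl⟩ := T.surjective v
      exact LinearMap.congr_fun h1 y
    have hdi : d i = 1 := by
      fin_cases i
      · exact hd01.1
      · exact hd01.2
      · exact absurd (diffForm_eq_zero_of_mem hL.2 he2 he2) hi
      · exact absurd (diffForm_eq_zero_of_mem hL.2 he2 he3) hi
    have h1 := diffForm_map hψF (e 2) (e i)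
    rw [he, he, diffForm_smul hF.1, hdi, one_smul, hd3, one_smul, hdet] at h1
    apply mul_right_cancel₀ hi
    rw [one_mul, ← h1]
  have hd3' : d 3 = d 2 ^ 2 := by
    linear_combination d 2 ^ 2 * hχ - d 3 * hd3 2
  have hζ : IsPrimitiveRoot (d 2) 3 := by
    have : Fact (Nat.Prime 3) := ⟨by norm_num⟩
    refine IsPrimitiveRoot.iff_orderOf.2 (orderOf_eq_prime (hd3 2) fun h2 => ?_)
    obtain ⟨v, hv⟩ := hψ1
    apply hv
    obtain ⟨y, rfl⟩ := T.surjective v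
    rw [hTd]
    congr 1
    funext i
    have : d i = 1 := by
      fin_cases i
      · exact hd01.1
      · exact hd01.2
      · exact h2
      · simpa [h2] using hd3'
    rw [this, one_mul]
  let P : MvPolynomial (Fin 4) ℂ := aeval (coordForm T.toLinearMap) F
  have hP : ∀ y, eval y P = eval (T y) F := fun y => by
    simp only [P]
    rw [aeval_eq_bind₁, eval_bind₁]
    simp only [eval_coordForm]
    rfl
  obtain ⟨q, g, a, b, a', b', hq, hg, hdec⟩ := exists_decomposition (P := P)
    (by simpa only [one_mul] using hF.1.aeval _ (isHomogeneous_coordForm T.toLinearMap)) hζ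
    (fun y => by
      have h1 := hψF (T y)
      rw [hTd, hdet, hχ, one_mul] at h1
      rw [hP, hP, ← h1]
      congr 3
      funext i
      fin_cases i <;> simp [hd01.1, hd01.2, hd3'])
    (by rw [hP]; exact hL.2 _ ((hT _).2 (by simp)))
  exact isSpecialLine_of_decomposition hF hL hT hq hg fun y => by rw [← hP, hdec]

lemma isSpecialLine_of_symmetry (hF : IsSmoothQuartic F) (hL : IsLineOn F L)
    {σ : Equiv.Perm (surface F)} {φ : V ≃ₗ[ℂ] V} (hσ : IsRestriction F σ φ)
    (hord : orderOf σ = 3) (hsymp : IsSymplectic F φ) (hplanes : PreservesPlanesThrough L φ) :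
    IsSpecialLine F L := by
  obtain ⟨χ, -, hχ⟩ := exists_eval_map_eq hF φ fun v hv => hσ.map_mem_cone hF hv
  have hdet := det_eq_of_isSymplectic hF hL φ hχ hsymp
  obtain ⟨⟨μ, hμ⟩, hns⟩ := (hσ.orderOf_eq_three_iff hF).1 hord
  obtain ⟨c, hc⟩ := exists_sub_smul_mem hL.1 hplanes
  obtain ⟨x, hx⟩ : ∃ x, x ∉ L := by
    by_contra! hall
    have h1 := hL.1
    rw [(Submodule.eq_top_iff').2 hall, finrank_top, Module.finrank_fin_fun] at h1
    omega
  have hx0 : x ≠ 0 := by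
    rintro rfl
    exact hx L.zero_mem
  -- The cube of `φ` is `μ` everywhere and `c³` modulo `L`.
  have hcμ : c ^ 3 = μ := by
    by_contra hne
    apply hx
    have h1 : (μ - c ^ 3) • x ∈ L := by
      have h2 := L.add_mem (L.add_mem (hc (φ (φ x))) (L.smul_mem c (hc (φ x))))
        (L.smul_mem (c ^ 2) (hc x))
      rw [hμ] at h2
      convert h2 using 1
      module
    rwa [L.smul_mem_iff (sub_ne_zero.2 (Ne.symm hne))] at h1
  have hc0 : c ≠ 0 := by
    rintro rfl
    have h1 := hμ x
    rw [← hcμ] at h1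
    simp [hx0] at h1
  refine isSpecialLine_of_linearMap hF hL (ψ := c⁻¹ • φ.toLinearMap) (fun v => ?_) ?_
    (fun v => ?_) (fun v => ?_)
  · simp only [LinearMap.smul_apply, LinearEquiv.coe_coe, map_smul, hμ, smul_smul, ← hcμ]
    rw [show c⁻¹ * c⁻¹ * (c⁻¹ * c ^ 3) = 1 by field_simp, one_smul]
  · by_contra! hall
    refine hns ⟨c, fun v => ?_⟩
    have h1 := hall v
    simp only [LinearMap.smul_apply, LinearEquiv.coe_coe] at h1
    rw [← h1, smul_smul, mul_inv_cancel₀ hc0, one_smul, h1]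
  · have h1 := L.smul_mem c⁻¹ (hc v)
    rwa [smul_sub, smul_smul, inv_mul_cancel₀ hc0, one_smul] at h1
  -- Rescaling by `c⁻¹` multiplies both `χ` and the determinant by `c⁻⁴`, since the degree of `F`
  -- equals the dimension of `V`.
  · rw [LinearMap.smul_apply, eval_smul_of_isHomogeneous hF.1, LinearMap.det_smul, hdet,
      Module.finrank_fin_fun, mul_assoc, ← hχ]
    rfl

end Converse

end QuarticSurface

theorem mainTheorem4 (F : MvPolynomial (Fin 4) ℂ) (hF : QuarticSurface.IsSmoothQuartic F)
    (L : Submodule ℂ QuarticSurface.V) (hL : QuarticSurface.IsLineOn F L) :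
    QuarticSurface.IsSpecialLine F L ↔
      ∃ (σ : Equiv.Perm (QuarticSurface.surface F))
        (φ : QuarticSurface.V ≃ₗ[ℂ] QuarticSurface.V),
        QuarticSurface.IsRestriction F σ φ ∧
        orderOf σ = 3 ∧
        QuarticSurface.IsSymplectic F φ ∧
        QuarticSurface.PreservesPlanesThrough L φ := by
  refine ⟨QuarticSurface.exists_symmetry_of_isSpecialLine hF hL, ?_⟩
  rintro ⟨σ, φ, hσ, hord, hsymp, hplanes⟩
  exact QuarticSurface.isSpecialLine_of_symmetry hF hL hσ hord hsymp hplanes
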